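/- Let $\theta\in\mathbb R\setminus\mathbb Q$, let $\mathbb Z$ act on $C(S^1)$ by $(\alpha_n f)(z)=f(e^{-2\pi i n\theta}z)$, and let $A_\theta=C(S^1)\rtimes_\alpha\mathbb Z$ be the (full) crossed product, that is, the completion of the $*$-algebra of finite sums $\sum_n f_n u_n$ (with $(f u_m)(g u_n)=f\,\alpha_m(g)\,u_{m+n}$ and $(f u_n)^*=\alpha_{-n}(f^*)\,u_{-n}$) in the norm $\|x\|=\sup\|(\pi\rtimes\rho)(x)\|$ over all covariant representations $(\pi,\rho)$ on Hilbert spaces. Let $U\in A_\theta$ be the image of the function $z\mapsto z$ and let $V=u_1^*=u_{-1}$, so that $U,V$ are unitaries with $VU=e^{2\pi i\theta}UV$. Then: (i) $A_\theta$ is simple (it is nonzero and has no closed two-sided ideals other than $0$ and $A_\theta$) and nuclear (the identity map of $A_\theta$ is a point-norm limit of compositions $A_\theta\to M_k(\mathbb C)\to A_\theta$ of contractive completely positive maps). (ii) $A_\theta$ has exactly one tracial state $\tau$; it is faithful, and $\tau(U^mV^n)=\delta_{m,0}\delta_{n,0}$ for all $m,n\in\mathbb Z$. (iii) The canonical $*$-homomorphism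 $C(S^1)\to A_\theta$ is injective with range $C^*(U)$, the C*-subalgebra generated by $U$ (and the unit), and $D=C^*(U)\cong C(S^1)$ is a Cartan subalgebra of $A_\theta$: $A_\theta$ is separable, $D$ is a maximal abelian C*-subalgebra, $D$ contains an approximate unit for $A_\theta$, the normalizer $\{n\in A_\theta: nDn^*\subseteq D,\ n^*Dn\subseteq D\}$ generates $A_\theta$ as a C*-algebra, and there is a faithful conditional expectation of $A_\theta$ onto $D$. (iv) The linear span of the monomials $U^mV^n$, $m,n\in\mathbb Z$, is a dense $*$-subalgebra of $A_\theta$, and for all $m,n,p,q\in\mathbb Z$, $$(U^mV^n)(U^pV^q)=e^{2\pi i\theta np}\,U^{m+p}V^{n+q}.$$ -/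

import Mathlib

open scoped ComplexOrder

noncomputable section

universe u v

/-! ## Full crossed products of unital C⋆-algebras by discrete groups -/

namespace CStarDynamics

variable {B : Type u} [CStarAlgebra B] {Γ : Type v} [Group Γ]

/-- The coefficient algebra `B` of a C⋆-dynamical system `(B, Γ, α)`, remembering the action `α`. -/
@[nolint unusedArguments]
def Coef (_α : Γ →* (B ≃⋆ₐ[ℂ] B)) : Type u := B

variable (α : Γ →* (B ≃⋆ₐ[ℂ] B))

instance : CStarAlgebra (Coef α) := inferInstanceAs (CStarAlgebra B)

instance : MulSemiringAction Γ (Coef α) where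
  smul g b := (α g : B ≃⋆ₐ[ℂ] B) (b : B)
  one_smul b := by
    change (α 1 : B ≃⋆ₐ[ℂ] B) (b : B) = b
    rw [map_one]; rfl
  mul_smul g h b := by
    change (α (g * h) : B ≃⋆ₐ[ℂ] B) (b : B) = (α g) ((α h) (b : B))
    rw [map_mul]; rfl
  smul_zero g := map_zero (α g)
  smul_add g := map_add (α g)
  smul_one g := map_one (α g)
  smul_mul g := map_mul (α g)

theorem coef_smul_def (g : Γ) (b : Coef α) : g • b = (α g : B ≃⋆ₐ[ℂ] B) (b : B) := rfl

instance : SMulCommClass Γ ℂ (Coef α) where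
  smul_comm g c b := map_smul (α g) c (b : B)

theorem coef_smul_star (g : Γ) (b : Coef α) : g • star b = star (g • b) :=
  map_star (α g) (b : B)

/-- The algebraic crossed product: finite formal sums `∑ a_g u_g` with
`(a u_g) (b u_h) = a α_g(b) u_{gh}` and `(a u_g)⋆ = α_{g⁻¹}(a⋆) u_{g⁻¹}`. The element `a u_g` is
`SkewMonoidAlgebra.single g a`. -/
def AlgCrossedProduct : Type (max u v) := SkewMonoidAlgebra (Coef α) Γ

instance : Ring (AlgCrossedProduct α) := inferInstanceAs (Ring (SkewMonoidAlgebra (Coef α) Γ))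

instance : Algebra ℂ (AlgCrossedProduct α) :=
  inferInstanceAs (Algebra ℂ (SkewMonoidAlgebra (Coef α) Γ))

namespace AlgCrossedProduct

/-- The element `b u_g` of the algebraic crossed product. -/
def single (g : Γ) (b : B) : AlgCrossedProduct α := SkewMonoidAlgebra.single (k := Coef α) g b

theorem single_add (g : Γ) (a b : B) : single α g (a + b) = single α g a + single α g b :=
  SkewMonoidAlgebra.single_add (k := Coef α) g a b

theorem single_zero (g : Γ) : single α g 0 = 0 :=
  SkewMonoidAlgebra.single_zero (k := Coef α) g

theorem smul_single (c : ℂ) (g : Γ) (b : B) : c • single α g b = single α g (c • b) :=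
  SkewMonoidAlgebra.smul_single (k := Coef α) c g b

theorem one_def : (1 : AlgCrossedProduct α) = single α 1 1 :=
  SkewMonoidAlgebra.one_def (k := Coef α) (G := Γ)

theorem single_mul_single (g h : Γ) (a b : B) :
    single α g a * single α h b = single α (g * h) (a * α g b) :=
  SkewMonoidAlgebra.single_mul_single (k := Coef α) (G := Γ)

variable {α} in
theorem induction {p : AlgCrossedProduct α → Prop} (x : AlgCrossedProduct α)
    (zero : p 0) (single : ∀ g b, p (single α g b)) (add : ∀ x y, p x → p y → p (x + y)) : p x :=
  SkewMonoidAlgebra.induction_on (k := Coef α) (G := Γ) x zero single add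

/-- The involution as an additive map. -/
def starHom : AlgCrossedProduct α →+ AlgCrossedProduct α :=
  (Finsupp.liftAddHom fun g : Γ =>
    AddMonoidHom.mk' (fun b : Coef α => single α g⁻¹ (α g⁻¹ (star (b : B)))) (fun a b =>
      (congrArg (single α g⁻¹) ((congrArg (α g⁻¹) (star_add (a : B) (b : B))).trans
        (map_add (α g⁻¹) _ _))).trans (single_add α g⁻¹ _ _))).comp
    (AddEquiv.toAddMonoidHom (SkewMonoidAlgebra.coeffAddEquiv (k := Coef α) (G := Γ)))

theorem starHom_single (g : Γ) (b : B) :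
    starHom α (single α g b) = single α g⁻¹ (α g⁻¹ (star b)) :=
  Finsupp.liftAddHom_apply_single (M := Coef α) _ g b

theorem apply_mul (g h : Γ) (b : B) : α (g * h) b = α g (α h b) := by
  rw [map_mul]; rfl

theorem apply_one (b : B) : α 1 b = b := by
  rw [map_one]; rfl

instance : StarRing (AlgCrossedProduct α) where
  star := starHom α
  star_involutive x := by
    change starHom α (starHom α x) = x
    induction x using induction with
    | zero => simp
    | single g b =>
      rw [starHom_single, starHom_single, ← map_star, star_star, ← apply_mul]
      simp
    | add x y hx hy => rw [map_add, map_add, hx, hy]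
  star_add x y := map_add (starHom α) x y
  star_mul x y := by
    change starHom α (x * y) = starHom α y * starHom α x
    induction x using induction with
    | zero => simp
    | single g a =>
      induction y using induction with
      | zero => simp
      | single h b =>
        rw [single_mul_single, starHom_single, starHom_single, starHom_single, single_mul_single,
          star_mul, ← map_star, map_mul, ← apply_mul, ← apply_mul, mul_inv_rev]
        simp
      | add x y hx hy => rw [mul_add, map_add, map_add, hx, hy, add_mul]
    | add x y hx hy => rw [add_mul, map_add, map_add, hx, hy, mul_add]

theorem star_single (g : Γ) (b : B) :
    star (single α g b) = single α g⁻¹ (α g⁻¹ (star b)) := starHom_single α g b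

instance : StarModule ℂ (AlgCrossedProduct α) where
  star_smul c x := by
    induction x using induction with
    | zero => simp
    | single g b => simp only [smul_single, star_single, star_smul, map_smul]
    | add x y hx hy => rw [smul_add, star_add, hx, hy, star_add, smul_add]

end AlgCrossedProduct

/-- A covariant representation of `(B, Γ, α)` on the Hilbert space `H`. -/
structure CovariantRep (H : Type*) [NormedAddCommGroup H] [InnerProductSpace ℂ H]
    [CompleteSpace H] where
  /-- the representation of the coefficient algebra -/
  π : B →⋆ₐ[ℂ] (H →L[ℂ] H)
  /-- the unitary representation of the group -/
  ρ : Γ →* unitary (H →L[ℂ] H)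
  covariant : ∀ (g : Γ) (b : B),
    (ρ g : H →L[ℂ] H) * π b * star (ρ g : H →L[ℂ] H) = π (α g b)

namespace CovariantRep

variable {α}
variable {H : Type*} [NormedAddCommGroup H] [InnerProductSpace ℂ H] [CompleteSpace H]

theorem covariant' (R : CovariantRep α H) (g : Γ) (b : B) :
    R.π (α g b) * (R.ρ g : H →L[ℂ] H) = (R.ρ g : H →L[ℂ] H) * R.π b := by
  rw [← R.covariant, mul_assoc, Unitary.coe_star_mul_self, mul_one]

/-- The integrated form `π ⋊ ρ : ∑ a_g u_g ↦ ∑ π(a_g) ρ(g)` as an algebra homomorphism. -/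
def integratedAlgHom (R : CovariantRep α H) : AlgCrossedProduct α →ₐ[ℂ] (H →L[ℂ] H) :=
  SkewMonoidAlgebra.liftNCAlgHom (k := ℂ) (G := Γ) (A := Coef α)
    (R.π.toAlgHom : B →ₐ[ℂ] (H →L[ℂ] H))
    ((unitary (H →L[ℂ] H)).subtype.comp R.ρ) (fun {x y} => R.covariant' y x)

theorem integratedAlgHom_single (R : CovariantRep α H) (g : Γ) (b : B) :
    R.integratedAlgHom (AlgCrossedProduct.single α g b) = R.π b * (R.ρ g : H →L[ℂ] H) :=
  SkewMonoidAlgebra.liftNC_single (k := Coef α) (G := Γ) _ _ g b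

/-- The integrated form `π ⋊ ρ : ∑ a_g u_g ↦ ∑ π(a_g) ρ(g)`. -/
def integrated (R : CovariantRep α H) : AlgCrossedProduct α →⋆ₐ[ℂ] (H →L[ℂ] H) where
  __ := R.integratedAlgHom
  map_star' x := by
    change R.integratedAlgHom (star x) = star (R.integratedAlgHom x)
    induction x using AlgCrossedProduct.induction with
    | zero => simp
    | single g b =>
      rw [AlgCrossedProduct.star_single, integratedAlgHom_single, integratedAlgHom_single,
        R.covariant', star_mul, map_inv, map_star]
      rfl
    | add x y hx hy => rw [star_add, map_add, hx, hy, map_add, star_add]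

theorem integrated_single (R : CovariantRep α H) (g : Γ) (b : B) :
    R.integrated (AlgCrossedProduct.single α g b) = R.π b * (R.ρ g : H →L[ℂ] H) :=
  R.integratedAlgHom_single g b

end CovariantRep

namespace AlgCrossedProduct

variable {α}

/-- The set of all norms `‖(π ⋊ ρ)(x)‖`, over all covariant representations `(π, ρ)`. Every cyclic
covariant representation is equivalent to one in this universe. -/
def repNorms (x : AlgCrossedProduct α) : Set ℝ :=
  {r | ∃ (H : Type (max u v)) (_ : NormedAddCommGroup H) (_ : InnerProductSpace ℂ H)
    (_ : CompleteSpace H) (R : CovariantRep α H), r = ‖R.integrated x‖}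

/-- The universal norm `‖x‖_max = sup ‖(π ⋊ ρ)(x)‖`. -/
def maxNorm (x : AlgCrossedProduct α) : ℝ := sSup (repNorms x)

theorem bddAbove_repNorms (x : AlgCrossedProduct α) : BddAbove (repNorms x) := by
  induction x using induction with
  | zero =>
    refine ⟨0, ?_⟩
    rintro _ ⟨H, _, _, _, R, rfl⟩
    simp
  | single g b =>
    refine ⟨‖b‖, ?_⟩
    rintro _ ⟨H, _, _, _, R, rfl⟩
    rw [R.integrated_single, CStarRing.norm_mul_coe_unitary]
    exact NonUnitalStarAlgHom.norm_apply_le R.π b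
  | add x y hx hy =>
    obtain ⟨c, hc⟩ := hx
    obtain ⟨d, hd⟩ := hy
    refine ⟨c + d, ?_⟩
    rintro _ ⟨H, i1, i2, i3, R, rfl⟩
    rw [map_add]
    exact (norm_add_le _ _).trans
      (add_le_add (hc ⟨H, i1, i2, i3, R, rfl⟩) (hd ⟨H, i1, i2, i3, R, rfl⟩))

theorem norm_integrated_le {H : Type (max u v)} [NormedAddCommGroup H] [InnerProductSpace ℂ H]
    [CompleteSpace H] (R : CovariantRep α H) (x : AlgCrossedProduct α) :
    ‖R.integrated x‖ ≤ maxNorm x :=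
  le_csSup (bddAbove_repNorms x) ⟨H, inferInstance, inferInstance, inferInstance, R, rfl⟩

theorem maxNorm_nonneg (x : AlgCrossedProduct α) : 0 ≤ maxNorm x := by
  apply Real.sSup_nonneg
  rintro _ ⟨H, _, _, _, R, rfl⟩
  exact norm_nonneg _

theorem maxNorm_le {x : AlgCrossedProduct α} {c : ℝ} (hc : 0 ≤ c)
    (h : ∀ (H : Type (max u v)) [NormedAddCommGroup H] [InnerProductSpace ℂ H]
      [CompleteSpace H] (R : CovariantRep α H), ‖R.integrated x‖ ≤ c) : maxNorm x ≤ c := by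
  refine Real.sSup_le ?_ hc
  rintro _ ⟨H, _, _, _, R, rfl⟩
  exact h H R

theorem maxNorm_mul_le (x y : AlgCrossedProduct α) : maxNorm (x * y) ≤ maxNorm x * maxNorm y := by
  refine maxNorm_le (mul_nonneg (maxNorm_nonneg x) (maxNorm_nonneg y)) fun H _ _ _ R => ?_
  rw [map_mul]
  exact (norm_mul_le _ _).trans (mul_le_mul (norm_integrated_le R x) (norm_integrated_le R y)
    (norm_nonneg _) (maxNorm_nonneg x))

theorem maxNorm_smul_le (c : ℂ) (x : AlgCrossedProduct α) : maxNorm (c • x) ≤ ‖c‖ * maxNorm x := by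
  refine maxNorm_le (mul_nonneg (norm_nonneg c) (maxNorm_nonneg x)) fun H _ _ _ R => ?_
  rw [map_smul, norm_smul]
  exact mul_le_mul_of_nonneg_left (norm_integrated_le R x) (norm_nonneg c)

theorem maxNorm_star_mul_self (x : AlgCrossedProduct α) :
    maxNorm x * maxNorm x ≤ maxNorm (star x * x) := by
  have h : maxNorm x ≤ √(maxNorm (star x * x)) := by
    refine maxNorm_le (Real.sqrt_nonneg _) fun H _ _ _ R => ?_
    apply Real.le_sqrt_of_sq_le
    rw [sq, ← CStarRing.norm_star_mul_self, ← map_star, ← map_mul]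
    exact norm_integrated_le R _
  calc maxNorm x * maxNorm x
      ≤ √(maxNorm (star x * x)) * √(maxNorm (star x * x)) :=
        mul_self_le_mul_self (maxNorm_nonneg x) h
    _ = _ := Real.mul_self_sqrt (maxNorm_nonneg _)

theorem maxNorm_star_le (x : AlgCrossedProduct α) : maxNorm (star x) ≤ maxNorm x := by
  refine maxNorm_le (maxNorm_nonneg x) fun H _ _ _ R => ?_
  rw [map_star, norm_star]
  exact norm_integrated_le R x

/-- The universal norm as a seminorm on the additive group. -/
def maxSeminorm : AddGroupSeminorm (AlgCrossedProduct α) where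
  toFun := maxNorm
  map_zero' := le_antisymm (maxNorm_le le_rfl fun H _ _ _ R => by simp) (maxNorm_nonneg 0)
  add_le' x y := maxNorm_le (add_nonneg (maxNorm_nonneg x) (maxNorm_nonneg y)) fun H _ _ _ R => by
    rw [map_add]
    exact (norm_add_le _ _).trans (add_le_add (norm_integrated_le R x) (norm_integrated_le R y))
  neg' x := by simp only [maxNorm, repNorms, map_neg, norm_neg]

instance : SeminormedRing (AlgCrossedProduct α) where
  __ := maxSeminorm.toSeminormedAddCommGroup
  __ := (inferInstance : Ring (AlgCrossedProduct α))
  norm_mul_le := maxNorm_mul_le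

theorem norm_def (x : AlgCrossedProduct α) : ‖x‖ = maxNorm x := rfl

instance : NormedAlgebra ℂ (AlgCrossedProduct α) where
  norm_smul_le := maxNorm_smul_le

theorem norm_star_le (x : AlgCrossedProduct α) : ‖star x‖ ≤ ‖x‖ := maxNorm_star_le x

theorem uniformContinuous_star : UniformContinuous (star : AlgCrossedProduct α → _) :=
  (AddMonoidHomClass.lipschitz_of_bound (starHom α) 1 fun x => by
    rw [one_mul]; exact norm_star_le x).uniformContinuous

end AlgCrossedProduct

open UniformSpace

/-- The full crossed product `B ⋊_α Γ`: the (Hausdorff) completion of the algebraic crossed product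
in the universal norm. -/
def CrossedProduct : Type (max u v) := Completion (AlgCrossedProduct α)

namespace CrossedProduct

instance : NormedRing (CrossedProduct α) :=
  inferInstanceAs (NormedRing (Completion (AlgCrossedProduct α)))

instance : CompleteSpace (CrossedProduct α) :=
  inferInstanceAs (CompleteSpace (Completion (AlgCrossedProduct α)))

instance : Algebra ℂ (CrossedProduct α) :=
  inferInstanceAs (Algebra ℂ (Completion (AlgCrossedProduct α)))

instance : NormedAlgebra ℂ (CrossedProduct α) where
  norm_smul_le := norm_smul_le (α := ℂ) (β := Completion (AlgCrossedProduct α))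

/-- The canonical map of the algebraic crossed product into its completion. -/
def ofAlg : AlgCrossedProduct α →ₐ[ℂ] CrossedProduct α where
  __ := (Completion.coeRingHom : AlgCrossedProduct α →+* Completion (AlgCrossedProduct α))
  commutes' _ := rfl

theorem norm_ofAlg (x : AlgCrossedProduct α) : ‖ofAlg α x‖ = AlgCrossedProduct.maxNorm x :=
  Completion.norm_coe x

theorem continuous_ofAlg : Continuous (ofAlg α) := Completion.continuous_coe _

theorem denseRange_ofAlg : DenseRange (ofAlg α) := Completion.denseRange_coe

variable {α} in
theorem induction {p : CrossedProduct α → Prop} (x : CrossedProduct α)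
    (hp : IsClosed {x | p x}) (h : ∀ a, p (ofAlg α a)) : p x :=
  Completion.induction_on x hp h

instance : Star (CrossedProduct α) where
  star := Completion.map (star : AlgCrossedProduct α → AlgCrossedProduct α)

theorem star_ofAlg (x : AlgCrossedProduct α) : star (ofAlg α x) = ofAlg α (star x) :=
  Completion.map_coe AlgCrossedProduct.uniformContinuous_star x

theorem continuous_star' : Continuous (star : CrossedProduct α → CrossedProduct α) :=
  Completion.continuous_map

instance : StarRing (CrossedProduct α) where
  star_involutive x := by
    induction x using induction with
    | hp => exact isClosed_eq ((continuous_star' α).comp (continuous_star' α)) continuous_id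
    | h a => rw [star_ofAlg, star_ofAlg, star_star]
  star_add x y := by
    induction x using induction with
    | hp =>
      exact isClosed_eq ((continuous_star' α).comp (continuous_id.add continuous_const))
        ((continuous_star' α).add continuous_const)
    | h a =>
      induction y using induction with
      | hp =>
        exact isClosed_eq ((continuous_star' α).comp (continuous_const.add continuous_id))
          (continuous_const.add (continuous_star' α))
      | h b => rw [← map_add, star_ofAlg, star_ofAlg, star_ofAlg, star_add, map_add]
  star_mul x y := by
    induction x using induction with
    | hp =>
      exact isClosed_eq ((continuous_star' α).comp (continuous_id.mul continuous_const))
        (continuous_const.mul (continuous_star' α))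
    | h a =>
      induction y using induction with
      | hp =>
        exact isClosed_eq ((continuous_star' α).comp (continuous_const.mul continuous_id))
          ((continuous_star' α).mul continuous_const)
      | h b => rw [← map_mul, star_ofAlg, star_ofAlg, star_ofAlg, star_mul, map_mul]

instance : StarModule ℂ (CrossedProduct α) where
  star_smul c x := by
    induction x using induction with
    | hp =>
      exact isClosed_eq ((continuous_star' α).comp (continuous_const_smul c))
        ((continuous_star' α).const_smul (star c))
    | h a => rw [← map_smul, star_ofAlg, star_ofAlg, star_smul, map_smul]

instance : CStarRing (CrossedProduct α) where
  norm_mul_self_le x := by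
    induction x using induction with
    | hp =>
      exact isClosed_le (continuous_norm.mul continuous_norm)
        (((continuous_star' α).mul continuous_id).norm)
    | h a =>
      rw [star_ofAlg, ← map_mul, norm_ofAlg, norm_ofAlg]
      exact AlgCrossedProduct.maxNorm_star_mul_self a

instance : CStarAlgebra (CrossedProduct α) where

/-- The order `a ≤ b` iff `b - a` is positive. -/
instance : PartialOrder (CrossedProduct α) := CStarAlgebra.spectralOrder _

instance : StarOrderedRing (CrossedProduct α) := CStarAlgebra.spectralOrderedRing _

/-- The canonical map `B → B ⋊_α Γ`. -/
def coefHom : B →⋆ₐ[ℂ] CrossedProduct α where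
  toFun b := ofAlg α (AlgCrossedProduct.single α 1 b)
  map_one' := by rw [← AlgCrossedProduct.one_def, map_one]
  map_mul' a b := by
    rw [← map_mul, AlgCrossedProduct.single_mul_single, AlgCrossedProduct.apply_one, one_mul]
  map_zero' := by rw [AlgCrossedProduct.single_zero, map_zero]
  map_add' a b := by rw [AlgCrossedProduct.single_add, map_add]
  commutes' c := by
    rw [Algebra.algebraMap_eq_smul_one, Algebra.algebraMap_eq_smul_one,
      ← AlgCrossedProduct.smul_single, map_smul, ← AlgCrossedProduct.one_def, map_one]
  map_star' b := by
    rw [star_ofAlg, AlgCrossedProduct.star_single, inv_one, AlgCrossedProduct.apply_one]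

/-- The canonical unitaries `u_g ∈ B ⋊_α Γ` implementing the action. -/
def groupUnitary : Γ →* unitary (CrossedProduct α) where
  toFun g := ⟨ofAlg α (AlgCrossedProduct.single α g 1), by
    rw [Unitary.mem_iff, star_ofAlg, ← map_mul, ← map_mul, AlgCrossedProduct.star_single,
      AlgCrossedProduct.single_mul_single, AlgCrossedProduct.single_mul_single]
    simp [← AlgCrossedProduct.one_def]⟩
  map_one' := Subtype.ext <| by
    change ofAlg α (AlgCrossedProduct.single α 1 1) = 1
    rw [← AlgCrossedProduct.one_def, map_one]
  map_mul' g h := Subtype.ext <| by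
    change ofAlg α (AlgCrossedProduct.single α (g * h) 1) =
      ofAlg α (AlgCrossedProduct.single α g 1) * ofAlg α (AlgCrossedProduct.single α h 1)
    rw [← map_mul, AlgCrossedProduct.single_mul_single, map_one, mul_one]

/-- The implementing relation `u_g b u_g⋆ = α_g(b)`. -/
theorem groupUnitary_covariant (g : Γ) (b : B) :
    (groupUnitary α g : CrossedProduct α) * coefHom α b * star (groupUnitary α g : CrossedProduct α)
      = coefHom α (α g b) := by
  change ofAlg α (AlgCrossedProduct.single α g 1) * ofAlg α (AlgCrossedProduct.single α 1 b) *
    star (ofAlg α (AlgCrossedProduct.single α g 1)) = ofAlg α (AlgCrossedProduct.single α 1 (α g b))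
  rw [star_ofAlg, ← map_mul, ← map_mul, AlgCrossedProduct.star_single,
    AlgCrossedProduct.single_mul_single, AlgCrossedProduct.single_mul_single]
  simp

end CrossedProduct
end CStarDynamics

/-! ## Structural notions for C⋆-algebras -/

namespace CStarStructure

/-- A unital C⋆-algebra is simple if it is nonzero and its only closed two-sided ideals are
`0` and the whole algebra. -/
def IsSimple (A : Type*) [CStarAlgebra A] : Prop :=
  Nontrivial A ∧ ∀ I : TwoSidedIdeal A, IsClosed (I : Set A) → I = ⊥ ∨ I = ⊤

/-- Nuclearity: the identity map is a point-norm limit of compositions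
`A → M_n(ℂ) → A` of contractive completely positive maps. -/
def IsNuclear (A : Type*) [NonUnitalCStarAlgebra A] [PartialOrder A] [StarOrderedRing A] : Prop :=
  ∀ (F : Finset A) (ε : ℝ), 0 < ε →
    ∃ (n : ℕ) (φ : CompletelyPositiveMap A (CStarMatrix (Fin n) (Fin n) ℂ))
      (ψ : CompletelyPositiveMap (CStarMatrix (Fin n) (Fin n) ℂ) A),
      (∀ a, ‖φ a‖ ≤ ‖a‖) ∧ (∀ M, ‖ψ M‖ ≤ ‖M‖) ∧ ∀ a ∈ F, ‖ψ (φ a) - a‖ < ε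

/-- Tracial states on a unital C⋆-algebra. -/
structure IsTracialState {A : Type*} [CStarAlgebra A] (τ : A →ₗ[ℂ] ℂ) : Prop where
  nonneg : ∀ a, 0 ≤ τ (star a * a)
  map_one : τ 1 = 1
  trace : ∀ a b, τ (a * b) = τ (b * a)

/-- Faithfulness of a positive linear map. -/
def IsFaithful {A E : Type*} [CStarAlgebra A] [AddCommGroup E] [Module ℂ E] (τ : A →ₗ[ℂ] E) :
    Prop :=
  ∀ a, τ (star a * a) = 0 → a = 0

section Cartan

variable {A : Type*} [NonUnitalCStarAlgebra A]

/-- `D` is a maximal abelian C⋆-subalgebra of `A`. -/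
structure IsMaximalAbelian (D : NonUnitalStarSubalgebra ℂ A) : Prop where
  isClosed : IsClosed (D : Set A)
  comm : ∀ x ∈ D, ∀ y ∈ D, x * y = y * x
  maximal : ∀ D' : NonUnitalStarSubalgebra ℂ A, IsClosed (D' : Set A) →
    (∀ x ∈ D', ∀ y ∈ D', x * y = y * x) → D ≤ D' → D' = D

/-- The normalizer `{n ∈ A | n D n⋆ ⊆ D and n⋆ D n ⊆ D}`. -/
def normalizer (D : NonUnitalStarSubalgebra ℂ A) : Set A :=
  {n | ∀ d ∈ D, n * d * star n ∈ D ∧ star n * d * n ∈ D}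

/-- `D` is regular in `A`: its normalizer generates `A` as a C⋆-algebra. -/
def IsRegular (D : NonUnitalStarSubalgebra ℂ A) : Prop :=
  (NonUnitalStarAlgebra.adjoin ℂ (normalizer D)).topologicalClosure = ⊤

variable [PartialOrder A] [StarOrderedRing A]

/-- `D` contains an approximate unit for `A`. -/
def ContainsApproximateUnit (D : NonUnitalStarSubalgebra ℂ A) : Prop :=
  ∃ l : Filter A, l.IsIncreasingApproximateUnit ∧ ∀ᶠ x in l, x ∈ D

/-- `E` is a conditional expectation of `A` onto `D`: a contractive completely positive projection
onto `D` that is `D`-bimodular. -/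
structure IsConditionalExpectation (D : NonUnitalStarSubalgebra ℂ A)
    (E : CompletelyPositiveMap A A) : Prop where
  mem : ∀ a, E a ∈ D
  apply_of_mem : ∀ d ∈ D, E d = d
  norm_le : ∀ a, ‖E a‖ ≤ ‖a‖
  mul_left : ∀ d ∈ D, ∀ a, E (d * a) = d * E a
  mul_right : ∀ d ∈ D, ∀ a, E (a * d) = E a * d

/-- `D` is a Cartan subalgebra of the C⋆-algebra `A`. -/
structure IsCartan (D : NonUnitalStarSubalgebra ℂ A) : Prop where
  separable : TopologicalSpace.SeparableSpace A
  maximalAbelian : IsMaximalAbelian D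
  approximateUnit : ContainsApproximateUnit D
  regular : IsRegular D
  expectation : ∃ E : CompletelyPositiveMap A A, IsConditionalExpectation D E ∧
    ∀ a, E (star a * a) = 0 → a = 0

end Cartan

end CStarStructure

/-! ## The irrational rotation algebra -/

namespace RotationAlgebra

open CStarDynamics

/-- The C⋆-algebra of continuous functions on the unit circle of `ℂ`. -/
abbrev CircleFunctions : Type := C(Circle, ℂ)

/-- The rotation action `(α_n f)(z) = f(e^{-2πinθ} z)` of `ℤ` on `C(S¹)`. -/
def rotationAction (θ : ℝ) : Multiplicative ℤ →* (CircleFunctions ≃⋆ₐ[ℂ] CircleFunctions) where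
  toFun n :=
    { toFun := fun f => f.comp
        ⟨fun z => Circle.exp (-(2 * Real.pi * (n.toAdd : ℝ) * θ)) * z, by fun_prop⟩
      invFun := fun f => f.comp
        ⟨fun z => Circle.exp (2 * Real.pi * (n.toAdd : ℝ) * θ) * z, by fun_prop⟩
      left_inv := fun f => by
        ext z
        simp [← mul_assoc]
      right_inv := fun f => by
        ext z
        simp [← mul_assoc]
      map_mul' := fun f g => rfl
      map_add' := fun f g => rfl
      map_star' := fun f => rfl
      map_smul' := fun c f => rfl }
  map_one' := by
    ext f z
    simp
  map_mul' m n := by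
    ext f z
    change f _ = f _
    congr 1
    change _ * z = _ * (_ * z)
    rw [← mul_assoc, ← Circle.exp_add, toAdd_mul]
    congr 2
    push_cast
    ring

theorem rotationAction_apply (θ : ℝ) (n : ℤ) (f : CircleFunctions) (z : Circle) :
    rotationAction θ (Multiplicative.ofAdd n) f z =
      f (Circle.exp (-(2 * Real.pi * (n : ℝ) * θ)) * z) := rfl

/-- The rotation algebra `A_θ = C(S¹) ⋊_α ℤ`. -/
abbrev rotationAlgebra (θ : ℝ) : Type := CrossedProduct (rotationAction θ)

/-- The canonical map `C(S¹) → A_θ`. -/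
def circleHom (θ : ℝ) : CircleFunctions →⋆ₐ[ℂ] rotationAlgebra θ :=
  CrossedProduct.coefHom (rotationAction θ)

/-- The identity function `z ↦ z`, as a unitary of `C(S¹)`. -/
def circleCoordinate : unitary CircleFunctions :=
  ⟨⟨fun z => (z : ℂ), by fun_prop⟩, by
    rw [Unitary.mem_iff]
    have h : ∀ z : Circle, (starRingEnd ℂ) (z : ℂ) * z = 1 := fun z => by
      rw [← Circle.coe_inv_eq_conj, ← Circle.coe_mul, inv_mul_cancel, Circle.coe_one]
    exact ⟨ContinuousMap.ext h, ContinuousMap.ext fun z => (mul_comm _ _).trans (h z)⟩⟩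

/-- The unitary `U ∈ A_θ` given by the function `z ↦ z`. -/
def U (θ : ℝ) : unitary (rotationAlgebra θ) :=
  ⟨circleHom θ circleCoordinate, Unitary.map_mem (circleHom θ) circleCoordinate.2⟩

/-- The unitary `V = u_{-1} = u_1⋆ ∈ A_θ`, where `u_n` are the canonical unitaries implementing
`α_n`. It satisfies `V U = e^{2πiθ} U V`. -/
def V (θ : ℝ) : unitary (rotationAlgebra θ) :=
  CrossedProduct.groupUnitary (rotationAction θ) (Multiplicative.ofAdd (-1))

/-- The monomial `U^m V^n`. -/
def monomial (θ : ℝ) (m n : ℤ) : rotationAlgebra θ :=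
  ((U θ ^ m * V θ ^ n : unitary (rotationAlgebra θ)) : rotationAlgebra θ)

end RotationAlgebra

end

/-! The proof averages over inner automorphisms. Conjugation by `U` or by `V` multiplies each
monomial `U^m V^n` by a phase, namely a power of `q = e^{2πiθ}`. The Cesàro means of conjugation by
powers of `U` therefore converge on monomials, and, being contractions, they converge in norm
everywhere. As `q` is not a root of unity, the limit `E` keeps the monomials with `n = 0` and kills
the others; the limit `F` for `V` keeps those with `m = 0`. Hence `F (E a) = τ(a) 1` for a
functional `τ`.

Faithfulness of `E` and `F` comes from almost periodicity. The conjugation orbit of an element is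
totally bounded, and this bounds a positive `b`, up to `ε`, by finitely many conjugates of its
average (`IsAverageLimit.eq_zero_of_nonneg`). So `τ` is a faithful trace. Any tracial state is
invariant under the averages and hence equals `τ`. A closed ideal is stable under the averages, so a
nonzero one contains a nonzero scalar `τ(a⋆a) 1`, which gives simplicity.

For nuclearity, `A` is compressed by `τ` to the monomials indexed by a finite set `s ⊂ ℤ²` and
mapped back by a normalized sum. The composite multiplies the monomial of index `r` by the
proportion of `t ∈ s` with `r + t ∈ s`, which tends to 1 along growing boxes
(`exists_cp_approximation`).

For the Cartan property, `E` is the conditional expectation onto `C*(U)`. It fixes whatever commutes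
with `U`, so `C*(U)` is maximal abelian, and the monomials normalize it. These arguments use only a
pair of unitaries with the commutation relation and dense monomials (`IsRotationPair`). The crossed
product enters through the density of the monomials and through one covariant representation that
shows `C(S¹)` embeds. -/

noncomputable section

/-! ### Cesàro averages of conjugation by a unitary, and faithfulness of their limits. -/

section Averages

open Filter Topology

theorem CStarMatrix.sum_apply {m n A ι : Type*} [AddCommMonoid A] (s : Finset ι)
    (f : ι → CStarMatrix m n A) (i : m) (j : n) : (∑ k ∈ s, f k) i j = ∑ k ∈ s, f k i j := by
  induction s using Finset.cons_induction with
  | empty => rfl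
  | cons a s ha ih => rw [Finset.sum_cons, Finset.sum_cons, CStarMatrix.add_apply, ih]

variable {A : Type*} [CStarAlgebra A]

/-- The Cesàro averages `(n + 1)⁻¹ ∑_{k ≤ n} w^k a w^{-k}`. -/
def unitaryAverage (w : unitary A) (n : ℕ) : A →ₗ[ℂ] A :=
  ((n : ℂ) + 1)⁻¹ • ∑ k ∈ Finset.range (n + 1),
    ((Unitary.conjStarAlgAut ℂ A (w ^ k)).toAlgEquiv.toLinearMap)

theorem unitaryAverage_apply (w : unitary A) (n : ℕ) (a : A) :
    unitaryAverage w n a = ((n : ℂ) + 1)⁻¹ • ∑ k ∈ Finset.range (n + 1),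
      Unitary.conjStarAlgAut ℂ A (w ^ k) a := by
  simp [unitaryAverage]

theorem norm_conjStarAlgAut (w : unitary A) (a : A) :
    ‖Unitary.conjStarAlgAut ℂ A w a‖ = ‖a‖ :=
  StarAlgEquiv.norm_map _ a

theorem norm_natCast_add_one (n : ℕ) : ‖((n : ℂ) + 1)‖ = n + 1 := by
  exact_mod_cast Complex.norm_natCast (n + 1)

theorem natCast_add_one_ne_zero_complex (n : ℕ) : ((n : ℂ) + 1) ≠ 0 := by
  exact_mod_cast n.succ_ne_zero

theorem norm_unitaryAverage_le (w : unitary A) (n : ℕ) (a : A) :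
    ‖unitaryAverage w n a‖ ≤ ‖a‖ := by
  rw [unitaryAverage_apply, norm_smul, norm_inv, norm_natCast_add_one,
    inv_mul_le_iff₀ (by positivity)]
  refine (norm_sum_le _ _).trans ?_
  simp only [norm_conjStarAlgAut]
  simp

theorem unitaryAverage_eq_self {w : unitary A} {a : A} (h : (w : A) * a = a * w) (n : ℕ) :
    unitaryAverage w n a = a := by
  have hk (k : ℕ) : Unitary.conjStarAlgAut ℂ A (w ^ k) a = a := by
    have hc : ((w ^ k : unitary A) : A) * a = a * (w ^ k : unitary A) := by
      rw [SubmonoidClass.coe_pow]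
      exact (Commute.pow_left (show Commute (w : A) a from h) k).eq
    rw [Unitary.conjStarAlgAut_apply, hc, mul_assoc, Unitary.mul_star_self_of_mem (w ^ k).2,
      mul_one]
  rw [unitaryAverage_apply, Finset.sum_congr rfl fun k _ => hk k]
  rw [Finset.sum_const, Finset.card_range, ← Nat.cast_smul_eq_nsmul ℂ, smul_smul]
  push_cast
  rw [inv_mul_cancel₀ (natCast_add_one_ne_zero_complex n), one_smul]

theorem conjStarAlgAut_pow_of_eigen {w : unitary A} {a : A} {c : ℂ}
    (h : Unitary.conjStarAlgAut ℂ A w a = c • a) (k : ℕ) :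
    Unitary.conjStarAlgAut ℂ A (w ^ k) a = c ^ k • a := by
  induction k with
  | zero => simp
  | succ k ih =>
    rw [pow_succ', map_mul, StarAlgEquiv.mul_apply, ih, map_smul, h, smul_smul, pow_succ]

/-- For `c ≠ 1` the partial sums of the geometric series `∑ c^k` stay bounded by `2 / ‖c - 1‖`, so
division by `n + 1` sends them to 0. -/
theorem tendsto_unitaryAverage_of_eigen {w : unitary A} {a : A} {c : ℂ} (hc : ‖c‖ = 1)
    (h : Unitary.conjStarAlgAut ℂ A w a = c • a) :
    Tendsto (fun n => unitaryAverage w n a) atTop (𝓝 (if c = 1 then a else 0)) := by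
  split_ifs with h1
  · subst h1
    refine tendsto_const_nhds.congr fun n => (unitaryAverage_eq_self ?_ n).symm
    rw [one_smul, Unitary.conjStarAlgAut_apply] at h
    conv_rhs => rw [← h]
    rw [mul_assoc _ _ (w : A), Unitary.coe_star_mul_self, mul_one]
  · have hlim : Tendsto (fun n : ℕ => (2 / ‖c - 1‖ * ‖a‖) * (1 / ((n : ℝ) + 1))) atTop (𝓝 0) := by
      simpa using tendsto_one_div_add_atTop_nhds_zero_nat.const_mul (2 / ‖c - 1‖ * ‖a‖)
    refine squeeze_zero_norm (fun n => ?_) hlim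
    rw [unitaryAverage_apply, Finset.sum_congr rfl fun k _ => conjStarAlgAut_pow_of_eigen h k,
      ← Finset.sum_smul, geom_sum_eq h1, norm_smul, norm_smul, norm_inv, norm_natCast_add_one,
      norm_div, one_div, mul_comm]
    gcongr
    calc ‖c ^ (n + 1) - 1‖ ≤ ‖c ^ (n + 1)‖ + ‖(1 : ℂ)‖ := norm_sub_le _ _
      _ = 2 := by rw [norm_pow, hc]; norm_num

theorem inv_natCast_add_one_nonneg (n : ℕ) : (0 : ℂ) ≤ ((n : ℂ) + 1)⁻¹ := by
  have h : ((n : ℂ) + 1)⁻¹ = (((n : ℝ) + 1)⁻¹ : ℝ) := by push_cast; rfl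
  rw [h, Complex.zero_le_real]
  positivity

/-- Pointwise convergence of contractions on a set with dense span gives a limit contraction. -/
theorem exists_limit_of_dense_span {X : Type*} [NormedAddCommGroup X] [NormedSpace ℂ X]
    [CompleteSpace X] {T : ℕ → X →ₗ[ℂ] X} (hT : ∀ n x, ‖T n x‖ ≤ ‖x‖) {S : Set X}
    (hS : Dense (Submodule.span ℂ S : Set X)) (h : ∀ s ∈ S, CauchySeq fun n => T n s) :
    ∃ E : X →L[ℂ] X, (∀ x, ‖E x‖ ≤ ‖x‖) ∧ ∀ x, Tendsto (fun n => T n x) atTop (𝓝 (E x)) := by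
  have hspan : ∀ x ∈ Submodule.span ℂ S, CauchySeq fun n => T n x := by
    intro x hx
    induction hx using Submodule.span_induction with
    | mem x hx => exact h x hx
    | zero => simpa using cauchySeq_const (0 : X)
    | add x y _ _ hx hy => simpa only [map_add] using! hx.add hy
    | smul c x _ hx =>
      simpa using (cauchySeq_tendsto_of_complete hx).elim fun l hl =>
        ((hl.const_smul c).cauchySeq : CauchySeq fun n => c • T n x)
  have hall : ∀ x, CauchySeq fun n => T n x := by
    intro x
    rw [Metric.cauchySeq_iff]
    intro ε hε
    obtain ⟨y, hy, hxy⟩ := Metric.dense_iff.mp hS x (ε / 3) (by positivity)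
    obtain ⟨N, hN⟩ := Metric.cauchySeq_iff.mp (hspan y hxy) (ε / 3) (by positivity)
    refine ⟨N, fun m hm n hn => ?_⟩
    have hd (k : ℕ) : dist (T k y) (T k x) < ε / 3 := by
      rw [dist_eq_norm, ← map_sub]
      exact (hT k _).trans_lt (by rwa [← dist_eq_norm])
    calc dist (T m x) (T n x)
        ≤ dist (T m x) (T m y) + dist (T m y) (T n y) + dist (T n y) (T n x) :=
          dist_triangle4 _ _ _ _
      _ < ε / 3 + ε / 3 + ε / 3 := by
          have := hd m; have := hd n; have := hN m hm n hn
          rw [dist_comm (T m x)]; linarith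
      _ = ε := by ring
  choose E hE using fun x => cauchySeq_tendsto_of_complete (hall x)
  have hnorm (x : X) : ‖E x‖ ≤ ‖x‖ :=
    le_of_tendsto (hE x).norm (Eventually.of_forall fun n => hT n x)
  refine ⟨LinearMap.mkContinuous ⟨⟨E, fun x y => ?_⟩, fun c x => ?_⟩ 1 (fun x => ?_), hnorm, hE⟩
  · exact tendsto_nhds_unique (hE (x + y)) (by simpa using (hE x).add (hE y))
  · exact tendsto_nhds_unique (hE (c • x)) (by simpa using (hE x).const_smul c)
  · rw [one_mul]; exact hnorm x

/-- `E` is the limit of the averages of conjugation by powers of `w`. -/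
structure IsAverageLimit (w : unitary A) (E : A →L[ℂ] A) : Prop where
  norm_le : ∀ a, ‖E a‖ ≤ ‖a‖
  tendsto : ∀ a, Tendsto (fun n => unitaryAverage w n a) atTop (𝓝 (E a))

/-- The eigenvectors, for eigenvalues on the unit circle, of conjugation by `w`. -/
def conjEigenvectors (w : unitary A) : Set A :=
  {a | ∃ c : ℂ, ‖c‖ = 1 ∧ Unitary.conjStarAlgAut ℂ A w a = c • a}

theorem exists_isAverageLimit {w : unitary A}
    (hw : Dense (Submodule.span ℂ (conjEigenvectors w) : Set A)) :
    ∃ E : A →L[ℂ] A, IsAverageLimit w E := by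
  obtain ⟨E, h1, h2⟩ := exists_limit_of_dense_span (norm_unitaryAverage_le w) hw
    fun s ⟨c, hc, hs⟩ => (tendsto_unitaryAverage_of_eigen hc hs).cauchySeq
  exact ⟨E, h1, h2⟩

/-- The orbit of an eigenvector lies on a compact circle of its multiples, and total boundedness
survives sums and scalings. It passes to limits because conjugation is isometric. -/
theorem totallyBounded_orbit {w : unitary A}
    (hw : Dense (Submodule.span ℂ (conjEigenvectors w) : Set A)) (a : A) :
    TotallyBounded (Set.range fun k : ℕ => Unitary.conjStarAlgAut ℂ A (w ^ k) a) := by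
  have hspan : ∀ x ∈ Submodule.span ℂ (conjEigenvectors w),
      TotallyBounded (Set.range fun k : ℕ => Unitary.conjStarAlgAut ℂ A (w ^ k) x) := by
    intro x hx
    induction hx using Submodule.span_induction with
    | mem x hx =>
      obtain ⟨c, hc, hx⟩ := hx
      refine TotallyBounded.subset ?_
        ((isCompact_sphere (0 : ℂ) 1).image (f := fun z => z • x) (by fun_prop)).totallyBounded
      rintro _ ⟨k, rfl⟩
      exact ⟨c ^ k, by simp [hc], (conjStarAlgAut_pow_of_eigen hx k).symm⟩
    | zero =>
      refine TotallyBounded.subset ?_ (Set.finite_singleton (0 : A)).totallyBounded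
      rintro _ ⟨k, rfl⟩
      simp
    | add x y _ _ hx hy =>
      refine TotallyBounded.subset ?_
        ((hx.closure.isCompact_of_isClosed isClosed_closure).add
          (hy.closure.isCompact_of_isClosed isClosed_closure)).totallyBounded
      rintro _ ⟨k, rfl⟩
      exact ⟨_, subset_closure ⟨k, rfl⟩, _, subset_closure ⟨k, rfl⟩, (map_add _ x y).symm⟩
    | smul c x _ hx =>
      refine TotallyBounded.subset ?_ (hx.image (uniformContinuous_const_smul c))
      rintro _ ⟨k, rfl⟩
      exact ⟨_, ⟨k, rfl⟩, (map_smul _ c x).symm⟩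
  rw [Metric.totallyBounded_iff]
  intro ε hε
  obtain ⟨b, hb, hbs⟩ := Metric.dense_iff.mp hw a (ε / 2) (by positivity)
  obtain ⟨t, ht, htb⟩ := Metric.totallyBounded_iff.mp (hspan b hbs) (ε / 2) (by positivity)
  refine ⟨t, ht, ?_⟩
  rintro _ ⟨k, rfl⟩
  obtain ⟨y, hy, hky⟩ := Set.mem_iUnion₂.mp (htb ⟨k, rfl⟩)
  refine Set.mem_iUnion₂.mpr ⟨y, hy, ?_⟩
  rw [Metric.mem_ball] at hky hb ⊢
  have h1 : dist (Unitary.conjStarAlgAut ℂ A (w ^ k) a) (Unitary.conjStarAlgAut ℂ A (w ^ k) b) <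
      ε / 2 := by
    rw [dist_eq_norm, ← map_sub, norm_conjStarAlgAut, ← dist_eq_norm, dist_comm]
    exact hb
  exact (dist_triangle _ _ _).trans_lt (by linarith)

variable [PartialOrder A] [StarOrderedRing A]

theorem IsAverageLimit.map_nonneg {w : unitary A} {E : A →L[ℂ] A} (hE : IsAverageLimit w E)
    {a : A} (ha : 0 ≤ a) : 0 ≤ E a := by
  refine ge_of_tendsto' (hE.tendsto a) fun n => ?_
  rw [unitaryAverage_apply]
  exact smul_nonneg (inv_natCast_add_one_nonneg n)
    (Finset.sum_nonneg fun k _ => _root_.map_nonneg _ ha)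

/-- Every conjugate of `b` is within `ε` of one of finitely many conjugates `w^j b w^{-j}`. Undoing
these `j` dominates `b - ε` by a finite sum of conjugates of `w^k b w^{-k}`, uniformly in `k`.
Averaging over `k` replaces `w^k b w^{-k}` by `E b = 0`, so `b ≤ ε`. -/
theorem IsAverageLimit.eq_zero_of_nonneg {w : unitary A} {E : A →L[ℂ] A}
    (hE : IsAverageLimit w E) (hw : Dense (Submodule.span ℂ (conjEigenvectors w) : Set A))
    {b : A} (hb : 0 ≤ b) (h0 : E b = 0) : b = 0 := by
  rw [← norm_le_zero_iff]
  refine le_of_forall_pos_le_add fun ε hε => ?_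
  rw [zero_add]
  -- The `ε`-net is chosen inside the orbit, so that each of its points is `w^j b w^{-j}` for some
  -- `j`.
  obtain ⟨t, ht, htf, hcov⟩ := (totallyBounded_orbit hw b).exists_subset
    (Metric.dist_mem_uniformity hε)
  choose j hj using fun y : t => ht y.2
  have := htf.fintype
  set s : t → A ≃⋆ₐ[ℂ] A := fun y => Unitary.conjStarAlgAut ℂ A (star (w ^ j y))
  have hs (y : t) (x : A) : s y (Unitary.conjStarAlgAut ℂ A (w ^ j y) x) = x := by
    rw [← StarAlgEquiv.mul_apply, ← map_mul, Unitary.star_mul_self, map_one]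
    rfl
  have key (k : ℕ) : b - algebraMap ℝ A ε ≤ ∑ y, s y (Unitary.conjStarAlgAut ℂ A (w ^ k) b) := by
    obtain ⟨y, hy, hky⟩ := Set.mem_iUnion₂.mp (hcov ⟨k, rfl⟩)
    have hpos (x : t) : 0 ≤ s x (Unitary.conjStarAlgAut ℂ A (w ^ k) b) :=
      _root_.map_nonneg _ (_root_.map_nonneg _ hb)
    -- One summand, that of the net point near `w^k b w^{-k}`, already suffices; the others are
    -- nonnegative and make the bound independent of `k`.
    refine le_trans ?_ (Finset.single_le_sum (fun x _ => hpos x) (Finset.mem_univ ⟨y, hy⟩))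
    set z := s ⟨y, hy⟩ (Unitary.conjStarAlgAut ℂ A (w ^ k) b)
    have hz : ‖b - z‖ ≤ ε := by
      rw [← hs ⟨y, hy⟩ b]
      change ‖s _ _ - s _ _‖ ≤ ε
      rw [← map_sub, norm_conjStarAlgAut, ← dist_eq_norm, dist_comm]
      have := hj ⟨y, hy⟩
      simp only at this
      rw [this]
      exact le_of_lt hky
    have hsa : IsSelfAdjoint (b - z) := (IsSelfAdjoint.of_nonneg hb).sub (.of_nonneg (hpos _))
    rw [sub_le_comm]
    refine (hsa.le_algebraMap_norm_self).trans ?_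
    exact algebraMap_mono A hz
  have hlim : Tendsto (fun n => ∑ y, s y (unitaryAverage w n b)) atTop (𝓝 0) := by
    have : Tendsto (fun n => ∑ y, s y (unitaryAverage w n b)) atTop (𝓝 (∑ y, s y (E b))) := by
      refine tendsto_finsetSum _ fun y _ => ?_
      have hc : Continuous (s y) := by
        have : Continuous fun x : A => (star (w ^ j y) : A) * x * star (star (w ^ j y) : A) := by
          fun_prop
        exact this
      exact (hc.tendsto _).comp (hE.tendsto b)
    simpa [h0] using this
  have hle : b - algebraMap ℝ A ε ≤ 0 := by
    refine ge_of_tendsto' hlim fun n => ?_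
    have hav : ∑ y, s y (unitaryAverage w n b) = ((n : ℂ) + 1)⁻¹ • ∑ k ∈ Finset.range (n + 1),
        ∑ y, s y (Unitary.conjStarAlgAut ℂ A (w ^ k) b) := by
      simp_rw [unitaryAverage_apply, map_smul, map_sum]
      rw [← Finset.smul_sum, Finset.sum_comm]
    have hcst : b - algebraMap ℝ A ε = ((n : ℂ) + 1)⁻¹ • ∑ k ∈ Finset.range (n + 1),
        (b - algebraMap ℝ A ε) := by
      rw [Finset.sum_const, Finset.card_range, ← Nat.cast_smul_eq_nsmul ℂ, smul_smul]
      push_cast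
      rw [inv_mul_cancel₀ (natCast_add_one_ne_zero_complex n), one_smul]
    rw [hav, hcst]
    exact smul_le_smul_of_nonneg_left (Finset.sum_le_sum fun k _ => key k)
      (inv_natCast_add_one_nonneg n)
  rw [CStarAlgebra.norm_le_iff_le_algebraMap b hε.le hb]
  exact sub_nonpos.mp hle

/-- The limit of the averages as a completely positive map. -/
def IsAverageLimit.toCompletelyPositiveMap {w : unitary A} {E : A →L[ℂ] A}
    (hE : IsAverageLimit w E) : CompletelyPositiveMap A A where
  toLinearMap := E
  map_cstarMatrix_nonneg' k M hM := by
    -- Matrices over `A` converge entrywise, so complete positivity passes from the averages to the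
    -- limit because the positive cone is closed.
    have hlim : Tendsto (fun n => M.map (unitaryAverage w n)) atTop (𝓝 (M.map E)) :=
      tendsto_pi_nhds.mpr fun i => tendsto_pi_nhds.mpr fun j => hE.tendsto (M i j)
    refine ge_of_tendsto' hlim fun n => ?_
    have : M.map (unitaryAverage w n) = ((n : ℂ) + 1)⁻¹ • ∑ k ∈ Finset.range (n + 1),
        M.map (Unitary.conjStarAlgAut ℂ A (w ^ k)) := by
      ext i j
      rw [CStarMatrix.smul_apply, CStarMatrix.sum_apply]
      exact unitaryAverage_apply w n (M i j)
    rw [this]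
    exact smul_nonneg (inv_natCast_add_one_nonneg n) (Finset.sum_nonneg fun l _ =>
      CompletelyPositiveMapClass.map_cstarMatrix_nonneg' _ k M hM)

end Averages

/-! ### Unitary pairs with `v u = q u v`: monomials, canonical trace, simplicity. -/

section RotationPair

open Filter Topology

variable {A : Type*} [CStarAlgebra A]

/-- Scalars of modulus one as unitaries. -/
def scalarUnitary (A : Type*) [CStarAlgebra A] : Circle →* unitary A where
  toFun z := ⟨(z : ℂ) • (1 : A), by
    have h1 : (starRingEnd ℂ) (z : ℂ) * z = 1 := by
      rw [← Circle.coe_inv_eq_conj, ← Circle.coe_mul, inv_mul_cancel, Circle.coe_one]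
    rw [Unitary.mem_iff]
    constructor <;> simp [smul_smul, h1, mul_comm (z : ℂ)]⟩
  map_one' := Subtype.ext (by simp)
  map_mul' x y := Subtype.ext (by simp [smul_smul, mul_comm])

theorem coe_scalarUnitary_mul (z : Circle) (w : unitary A) :
    ((scalarUnitary A z * w : unitary A) : A) = (z : ℂ) • (w : A) := by
  simp [scalarUnitary]

theorem scalarUnitary_commute (z : Circle) (w : unitary A) : Commute (scalarUnitary A z) w :=
  Subtype.ext (by simp [scalarUnitary])

/-- The monomial `u^m v^n`. -/
def unitaryMonomial (u v : unitary A) (p : ℤ × ℤ) : A := ((u ^ p.1 * v ^ p.2 : unitary A) : A)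

/-- Unitaries `u`, `v` with `v u = q u v` whose monomials have dense span. -/
structure IsRotationPair (q : Circle) (u v : unitary A) : Prop where
  comm : (v : A) * u = (q : ℂ) • ((u : A) * v)
  dense : Dense (Submodule.span ℂ (Set.range (unitaryMonomial u v)) : Set A)

/-- Conjugation by `v` scales `u` by `q`, hence `u^p` by `q^p`. Read as a statement about
conjugation of `v` by `u^{-p}`, this can then be raised to the power `n`. Treating scalars as
central unitaries keeps the computation inside a group, where integer powers are available. -/
theorem zpow_mul_zpow_of_comm {q : Circle} {u v : unitary A}
    (h : (v : A) * u = (q : ℂ) • ((u : A) * v)) (n p : ℤ) :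
    v ^ n * u ^ p = scalarUnitary A (q ^ (n * p)) * (u ^ p * v ^ n) := by
  have h1 : v * u * v⁻¹ = scalarUnitary A q * u := by
    rw [mul_inv_eq_iff_eq_mul, mul_assoc]
    exact Subtype.ext (by rw [coe_scalarUnitary_mul]; exact h)
  have h2 : v * u ^ p * v⁻¹ = scalarUnitary A (q ^ p) * u ^ p := by
    rw [← conj_zpow, h1, (scalarUnitary_commute q u).mul_zpow, map_zpow]
  have h3 : (u ^ p)⁻¹ * v * u ^ p = scalarUnitary A (q ^ p) * v := by
    rw [mul_inv_eq_iff_eq_mul] at h2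
    rw [mul_assoc, h2, mul_assoc, (scalarUnitary_commute _ _).symm.left_comm, inv_mul_cancel_left]
  have h4 : (u ^ p)⁻¹ * v ^ n * u ^ p = scalarUnitary A (q ^ (n * p)) * v ^ n := by
    have := conj_zpow (a := (u ^ p)⁻¹) (b := v) (i := n)
    rw [inv_inv] at this
    rw [← this, h3, (scalarUnitary_commute _ v).mul_zpow, ← map_zpow, ← zpow_mul, mul_comm p]
  rw [mul_assoc, inv_mul_eq_iff_eq_mul] at h4
  rw [h4, (scalarUnitary_commute _ _).symm.left_comm]

section Commutation

variable {q : Circle} {u v : unitary A} (h : (v : A) * u = (q : ℂ) • ((u : A) * v))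

include h

theorem monomial_mul_of_comm (a b : ℤ × ℤ) :
    (u ^ a.1 * v ^ a.2) * (u ^ b.1 * v ^ b.2) =
      scalarUnitary A (q ^ (a.2 * b.1)) * (u ^ (a.1 + b.1) * v ^ (a.2 + b.2)) := by
  rw [mul_assoc, ← mul_assoc (v ^ a.2), zpow_mul_zpow_of_comm h, zpow_add, zpow_add]
  simp only [mul_assoc]
  rw [(scalarUnitary_commute _ (u ^ a.1)).left_comm]

theorem unitaryMonomial_mul_of_comm (a b : ℤ × ℤ) :
    unitaryMonomial u v a * unitaryMonomial u v b =
      ((q ^ (a.2 * b.1) : Circle) : ℂ) • unitaryMonomial u v (a + b) := by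
  rw [unitaryMonomial, unitaryMonomial, ← Submonoid.coe_mul, monomial_mul_of_comm h,
    coe_scalarUnitary_mul]
  rfl

theorem star_unitaryMonomial_of_comm (a : ℤ × ℤ) :
    star (unitaryMonomial u v a) = ((q ^ (a.2 * a.1) : Circle) : ℂ) • unitaryMonomial u v (-a) := by
  have h1 : (u ^ a.1 * v ^ a.2)⁻¹ =
      scalarUnitary A (q ^ (a.2 * a.1)) * (u ^ (-a.1) * v ^ (-a.2)) := by
    have := monomial_mul_of_comm h a (-a)
    simp only [Prod.fst_neg, Prod.snd_neg, add_neg_cancel, zpow_zero, mul_one] at this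
    rw [inv_eq_iff_mul_eq_one, ← (scalarUnitary_commute _ _).left_comm, this, ← map_mul,
      ← zpow_add, mul_neg, add_neg_cancel, zpow_zero, map_one]
  change ((u ^ a.1 * v ^ a.2)⁻¹ : unitary A).1 = _
  rw [h1, coe_scalarUnitary_mul]
  rfl

/-- The span of the monomials is a `⋆`-subalgebra. -/
def monomialSubalgebra : StarSubalgebra ℂ A where
  carrier := Submodule.span ℂ (Set.range (unitaryMonomial u v))
  add_mem' := add_mem
  mul_mem' {x y} hx hy := by
    have key : Submodule.span ℂ (Set.range (unitaryMonomial u v)) *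
        Submodule.span ℂ (Set.range (unitaryMonomial u v)) ≤
          Submodule.span ℂ (Set.range (unitaryMonomial u v)) := by
      rw [Submodule.span_mul_span, Submodule.span_le]
      rintro _ ⟨_, ⟨a, rfl⟩, _, ⟨b, rfl⟩, rfl⟩
      change unitaryMonomial u v a * unitaryMonomial u v b ∈ _
      rw [unitaryMonomial_mul_of_comm h]
      exact Submodule.smul_mem _ _ (Submodule.subset_span ⟨_, rfl⟩)
    exact key (Submodule.mul_mem_mul hx hy)
  algebraMap_mem' c := by
    rw [Algebra.algebraMap_eq_smul_one]
    exact Submodule.smul_mem _ _ (Submodule.subset_span ⟨0, by simp [unitaryMonomial]⟩)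
  star_mem' {x} hx := by
    induction hx using Submodule.span_induction with
    | mem x hx =>
      obtain ⟨a, rfl⟩ := hx
      rw [star_unitaryMonomial_of_comm h]
      exact Submodule.smul_mem _ _ (Submodule.subset_span ⟨_, rfl⟩)
    | zero => rw [star_zero]; exact zero_mem _
    | add x y _ _ hx hy => rw [star_add]; exact add_mem hx hy
    | smul c x _ hx => rw [star_smul]; exact Submodule.smul_mem _ _ hx

end Commutation

namespace IsRotationPair

variable {q : Circle} {u v : unitary A} (h : IsRotationPair q u v)

include h

theorem unitaryMonomial_mul (a b : ℤ × ℤ) :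
    unitaryMonomial u v a * unitaryMonomial u v b =
      ((q ^ (a.2 * b.1) : Circle) : ℂ) • unitaryMonomial u v (a + b) :=
  unitaryMonomial_mul_of_comm h.comm a b

theorem star_unitaryMonomial (a : ℤ × ℤ) :
    star (unitaryMonomial u v a) = ((q ^ (a.2 * a.1) : Circle) : ℂ) • unitaryMonomial u v (-a) :=
  star_unitaryMonomial_of_comm h.comm a

theorem conj_u (a : ℤ × ℤ) : Unitary.conjStarAlgAut ℂ A u (unitaryMonomial u v a) =
    ((q ^ (-a.2) : Circle) : ℂ) • unitaryMonomial u v a := by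
  have h1 : u * (u ^ a.1 * v ^ a.2) * u⁻¹ =
      scalarUnitary A (q ^ (-a.2)) * (u ^ a.1 * v ^ a.2) := by
    have := zpow_mul_zpow_of_comm h.comm a.2 (-1)
    rw [zpow_neg_one] at this
    rw [mul_assoc, mul_assoc, this, mul_neg_one,
      (scalarUnitary_commute _ (u ^ a.1)).symm.left_comm,
      (scalarUnitary_commute _ u).symm.left_comm, ← mul_assoc (u ^ a.1), ← zpow_sub_one,
      ← mul_assoc u,
      ← zpow_one_add, add_sub_cancel]
  have h2 := congrArg (Subtype.val) h1
  rw [coe_scalarUnitary_mul] at h2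
  exact h2

theorem conj_v (a : ℤ × ℤ) : Unitary.conjStarAlgAut ℂ A v (unitaryMonomial u v a) =
    ((q ^ a.1 : Circle) : ℂ) • unitaryMonomial u v a := by
  have h1 : v * (u ^ a.1 * v ^ a.2) * v⁻¹ =
      scalarUnitary A (q ^ a.1) * (u ^ a.1 * v ^ a.2) := by
    have := zpow_mul_zpow_of_comm h.comm 1 a.1
    rw [zpow_one, one_mul] at this
    rw [← mul_assoc, this, mul_assoc, mul_assoc, mul_assoc, ← zpow_sub_one, ← zpow_one_add,
      add_sub_cancel]
  have h2 := congrArg (Subtype.val) h1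
  rw [coe_scalarUnitary_mul] at h2
  exact h2

theorem dense_conjEigenvectors_u : Dense (Submodule.span ℂ (conjEigenvectors u) : Set A) :=
  h.dense.mono <| Submodule.span_mono <| by
    rintro _ ⟨a, rfl⟩
    exact ⟨_, Circle.norm_coe _, h.conj_u a⟩

theorem dense_conjEigenvectors_v : Dense (Submodule.span ℂ (conjEigenvectors v) : Set A) :=
  h.dense.mono <| Submodule.span_mono <| by
    rintro _ ⟨a, rfl⟩
    exact ⟨_, Circle.norm_coe _, h.conj_v a⟩

/-- A closed condition that is stable under linear combinations holds everywhere if it holds for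
monomials. -/
theorem mem_of_monomial {K : Submodule ℂ A} (hK : IsClosed (K : Set A))
    (hm : ∀ a, unitaryMonomial u v a ∈ K) (x : A) : x ∈ K := by
  have h1 : Submodule.span ℂ (Set.range (unitaryMonomial u v)) ≤ K :=
    Submodule.span_le.mpr (by rintro _ ⟨a, rfl⟩; exact hm a)
  exact hK.closure_subset_iff.mpr h1 (h.dense x)

theorem clm_ext {X : Type*} [NormedAddCommGroup X] [NormedSpace ℂ X] {f g : A →L[ℂ] X}
    (hfg : ∀ a, f (unitaryMonomial u v a) = g (unitaryMonomial u v a)) : f = g := by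
  ext x
  exact h.mem_of_monomial (K := LinearMap.eqLocus (f : A →ₗ[ℂ] X) (g : A →ₗ[ℂ] X))
    (isClosed_eq f.continuous g.continuous) hfg x

theorem average_faithful [PartialOrder A] [StarOrderedRing A] {E F : A →L[ℂ] A}
    (hE : IsAverageLimit u E) (hF : IsAverageLimit v F) {b : A} (hb : 0 ≤ b)
    (h0 : F (E b) = 0) : b = 0 :=
  hE.eq_zero_of_nonneg h.dense_conjEigenvectors_u hb <|
    hF.eq_zero_of_nonneg h.dense_conjEigenvectors_v (hE.map_nonneg hb) h0

variable (hq : ∀ n : ℤ, q ^ n = 1 → n = 0)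

include hq

/-- The eigenvalue `q^{-a.2}` equals 1 only for `a.2 = 0`; this is where irrationality enters. -/
theorem averageLimit_u {E : A →L[ℂ] A} (hE : IsAverageLimit u E) (a : ℤ × ℤ) :
    E (unitaryMonomial u v a) = if a.2 = 0 then unitaryMonomial u v a else 0 := by
  have h1 := tendsto_unitaryAverage_of_eigen (Circle.norm_coe _) (h.conj_u a)
  rw [tendsto_nhds_unique (hE.tendsto _) h1]
  refine if_congr ?_ rfl rfl
  rw [Circle.coe_eq_one]
  exact ⟨fun h => by simpa using hq _ h, fun h => by simp [h]⟩

theorem averageLimit_v {E : A →L[ℂ] A} (hE : IsAverageLimit v E) (a : ℤ × ℤ) :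
    E (unitaryMonomial u v a) = if a.1 = 0 then unitaryMonomial u v a else 0 := by
  have h1 := tendsto_unitaryAverage_of_eigen (Circle.norm_coe _) (h.conj_v a)
  rw [tendsto_nhds_unique (hE.tendsto _) h1]
  refine if_congr ?_ rfl rfl
  rw [Circle.coe_eq_one]
  exact ⟨fun h => by simpa using hq _ h, fun h => by simp [h]⟩

theorem averageLimit_comp {E F : A →L[ℂ] A} (hE : IsAverageLimit u E) (hF : IsAverageLimit v F)
    (a : ℤ × ℤ) : F (E (unitaryMonomial u v a)) = if a = 0 then 1 else 0 := by
  rw [h.averageLimit_u hq hE]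
  obtain ⟨m, n⟩ := a
  by_cases hn : n = 0
  · subst hn
    rw [if_pos rfl, h.averageLimit_v hq hF]
    by_cases hm : m = 0
    · subst hm; simp [unitaryMonomial]
    · simp [hm]
  · simp [hn]

/-- The canonical trace: `τ(a) 1` is the average of `a` over conjugations by `u` and `v`. -/
theorem exists_trace [Nontrivial A] {E F : A →L[ℂ] A} (hE : IsAverageLimit u E)
    (hF : IsAverageLimit v F) : ∃ τ : A →L[ℂ] ℂ, ∀ a, F (E a) = τ a • 1 := by
  -- Any continuous functional with `g 1 = 1` serves here: it only reads off the coefficient of a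
  -- multiple of 1.
  obtain ⟨g, -, hg⟩ := exists_dual_vector ℂ (1 : A) (norm_ne_zero_iff.mpr one_ne_zero)
  have hg1 : g 1 = 1 := by rw [hg]; simp
  refine ⟨g ∘L F ∘L E, fun a => ?_⟩
  have : F ∘L E = (g ∘L F ∘L E).smulRight 1 := h.clm_ext fun b => by
    simp only [ContinuousLinearMap.comp_apply, ContinuousLinearMap.smulRight_apply,
      h.averageLimit_comp hq hE hF]
    split_ifs <;> simp [hg1]
  exact DFunLike.congr_fun this a

end IsRotationPair

/-- The canonical tracial functional of a rotation pair. -/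
structure IsCanonicalTrace (u v : unitary A) (τ : A →L[ℂ] ℂ) : Prop where
  apply_monomial : ∀ a, τ (unitaryMonomial u v a) = if a = 0 then 1 else 0
  isTracialState : CStarStructure.IsTracialState (τ : A →ₗ[ℂ] ℂ)
  isFaithful : CStarStructure.IsFaithful (τ : A →ₗ[ℂ] ℂ)

/-- A tracial state is assumed only linear and positive; continuity is automatic from positivity and
is needed to pass to the limit of the averages. -/
theorem continuous_tracialState {τ : A →ₗ[ℂ] ℂ} (hτ : CStarStructure.IsTracialState τ) :
    Continuous τ := by
  let _ : PartialOrder A := CStarAlgebra.spectralOrder A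
  have _ : StarOrderedRing A := CStarAlgebra.spectralOrderedRing A
  have hpos : ∀ a, 0 ≤ a → 0 ≤ τ a := by
    intro a ha
    obtain ⟨b, rfl⟩ := CStarAlgebra.nonneg_iff_eq_star_mul_self.mp ha
    exact hτ.nonneg b
  let f : A →ₚ[ℂ] ℂ := PositiveLinearMap.mk₀ τ hpos
  exact map_continuous f

theorem tracialState_unitaryAverage {τ : A →ₗ[ℂ] ℂ} (hτ : CStarStructure.IsTracialState τ)
    (w : unitary A) (n : ℕ) (a : A) : τ (unitaryAverage w n a) = τ a := by
  have hk (k : ℕ) : τ (Unitary.conjStarAlgAut ℂ A (w ^ k) a) = τ a := by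
    rw [Unitary.conjStarAlgAut_apply, hτ.trace, ← mul_assoc, Unitary.star_mul_self_of_mem (w ^ k).2,
      one_mul]
  rw [unitaryAverage_apply, map_smul, map_sum, Finset.sum_congr rfl fun k _ => hk k,
    Finset.sum_const, Finset.card_range, ← Nat.cast_smul_eq_nsmul ℂ, smul_smul]
  push_cast
  rw [inv_mul_cancel₀ (natCast_add_one_ne_zero_complex n), one_smul]

theorem tracialState_averageLimit {τ : A →ₗ[ℂ] ℂ} (hτ : CStarStructure.IsTracialState τ)
    {w : unitary A} {E : A →L[ℂ] A} (hE : IsAverageLimit w E) (a : A) : τ (E a) = τ a := by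
  refine tendsto_nhds_unique (((continuous_tracialState hτ).tendsto _).comp (hE.tendsto a)) ?_
  exact tendsto_const_nhds.congr fun n => (tracialState_unitaryAverage hτ w n a).symm

theorem tracialState_unique {u v : unitary A} {E F : A →L[ℂ] A} (hE : IsAverageLimit u E)
    (hF : IsAverageLimit v F) {τ : A →L[ℂ] ℂ} (hτ : ∀ a, F (E a) = τ a • 1)
    {τ' : A →ₗ[ℂ] ℂ} (hτ' : CStarStructure.IsTracialState τ') : τ' = τ := by
  ext a
  rw [← tracialState_averageLimit hτ' hE, ← tracialState_averageLimit hτ' hF, hτ, map_smul,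
    hτ'.map_one]
  simp

namespace IsRotationPair

variable {q : Circle} {u v : unitary A} (h : IsRotationPair q u v)
  (hq : ∀ n : ℤ, q ^ n = 1 → n = 0)

include h hq

theorem isCanonicalTrace [Nontrivial A] {E F : A →L[ℂ] A} (hE : IsAverageLimit u E)
    (hF : IsAverageLimit v F) {τ : A →L[ℂ] ℂ} (hτ : ∀ a, F (E a) = τ a • 1) :
    IsCanonicalTrace u v τ := by
  let _ : PartialOrder A := CStarAlgebra.spectralOrder A
  have _ : StarOrderedRing A := CStarAlgebra.spectralOrderedRing A
  have hm (a : ℤ × ℤ) : τ (unitaryMonomial u v a) = if a = 0 then 1 else 0 := by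
    have := (hτ (unitaryMonomial u v a)).symm.trans (h.averageLimit_comp hq hE hF a)
    split_ifs with ha
    · rw [if_pos ha] at this
      exact smul_left_injective ℂ (one_ne_zero (α := A)) (by simpa using this)
    · rw [if_neg ha] at this
      simpa using this
  refine ⟨hm, ⟨fun a => ?_, ?_, ?_⟩, fun a ha => ?_⟩
  · have h1 : 0 ≤ algebraMap ℂ A (τ (star a * a)) := by
      rw [Algebra.algebraMap_eq_smul_one, ← hτ]
      exact hF.map_nonneg (hE.map_nonneg (star_mul_self_nonneg a))
    exact spectrum_nonneg_of_nonneg h1 (by rw [spectrum.scalar_eq]; rfl)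
  · simpa [unitaryMonomial] using hm 0
  · have hbil : ∀ x b, τ (x * unitaryMonomial u v b) = τ (unitaryMonomial u v b * x) := by
      intro x b
      have := h.clm_ext (f := τ ∘L (ContinuousLinearMap.mul ℂ A).flip (unitaryMonomial u v b))
        (g := τ ∘L (ContinuousLinearMap.mul ℂ A) (unitaryMonomial u v b)) fun a => by
          simp only [ContinuousLinearMap.comp_apply, ContinuousLinearMap.flip_apply,
            ContinuousLinearMap.mul_apply', h.unitaryMonomial_mul, map_smul, hm, add_comm b]
          -- For `a = -b` the two phases are both `q^{-b.1 b.2}`; otherwise `τ` vanishes on both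
          -- products.
          by_cases hab : a + b = 0
          · rw [eq_neg_of_add_eq_zero_left hab]
            simp [mul_comm]
          · simp [hab]
      exact DFunLike.congr_fun this x
    intro x y
    have := h.clm_ext (f := τ ∘L (ContinuousLinearMap.mul ℂ A) x)
        (g := τ ∘L (ContinuousLinearMap.mul ℂ A).flip x) fun b => hbil x b
    exact DFunLike.congr_fun this y
  · have h1 : star a * a = 0 := by
      refine h.average_faithful hE hF (star_mul_self_nonneg a) ?_
      rw [hτ]
      have : τ (star a * a) = 0 := ha
      rw [this, zero_smul]
    exact CStarRing.star_mul_self_eq_zero_iff a |>.mp h1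

theorem isSimple [Nontrivial A] : CStarStructure.IsSimple A := by
  let _ : PartialOrder A := CStarAlgebra.spectralOrder A
  have _ : StarOrderedRing A := CStarAlgebra.spectralOrderedRing A
  obtain ⟨E, hE⟩ := exists_isAverageLimit h.dense_conjEigenvectors_u
  obtain ⟨F, hF⟩ := exists_isAverageLimit h.dense_conjEigenvectors_v
  obtain ⟨τ, hτ⟩ := h.exists_trace hq hE hF
  refine ⟨inferInstance, fun I hI => or_iff_not_imp_left.mpr fun hne => ?_⟩
  -- A closed ideal is stable under conjugation, hence under averages and their limits.
  have hav (w : unitary A) (G : A →L[ℂ] A) (hG : IsAverageLimit w G) {b : A} (hb : b ∈ I) :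
      G b ∈ I := by
    refine hI.mem_of_tendsto (hG.tendsto b) (Eventually.of_forall fun n => ?_)
    change unitaryAverage w n b ∈ I
    rw [unitaryAverage_apply, ← smul_one_mul]
    refine I.mul_mem_left _ _ (sum_mem fun k _ => ?_)
    exact I.mul_mem_right _ _ (I.mul_mem_left _ _ hb)
  obtain ⟨a, ha, ha0⟩ : ∃ a ∈ I, a ≠ 0 := by
    by_contra hcon
    push Not at hcon
    refine hne (le_bot_iff.mp fun x hx => ?_)
    rw [TwoSidedIdeal.mem_bot]
    exact hcon x hx
  have h1 := hav v F hF (hav u E hE (I.mul_mem_left (star a) a ha))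
  have hne0 : τ (star a * a) ≠ 0 := fun h0 =>
    ha0 ((h.isCanonicalTrace hq hE hF hτ).isFaithful a h0)
  rw [hτ] at h1
  have h2 : (1 : A) ∈ I := by
    have := I.mul_mem_left ((τ (star a * a))⁻¹ • 1) _ h1
    rwa [smul_mul_smul_comm, inv_mul_cancel₀ hne0, one_smul, one_mul] at this
  rw [eq_top_iff]
  intro x _
  simpa using I.mul_mem_left x 1 h2

end IsRotationPair

end RotationPair

/-! ### Gram matrices, the Kadison–Schwarz inequality, and maps to and from matrix algebras. -/

section CompletePositivity

open Filter Topology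

variable {A B : Type*} [CStarAlgebra A] [PartialOrder A] [StarOrderedRing A]
  [CStarAlgebra B] [PartialOrder B] [StarOrderedRing B]

theorem inv_natCast_nonneg (n : ℕ) : (0 : ℂ) ≤ ((n : ℂ))⁻¹ := by
  have h : ((n : ℂ))⁻¹ = ((n : ℝ)⁻¹ : ℝ) := by push_cast; rfl
  rw [h, Complex.zero_le_real]
  positivity

theorem exists_eq_star_mul_self_of_nonneg {C : Type*} [NonUnitalCStarAlgebra C] [PartialOrder C]
    [StarOrderedRing C] {c : C} (hc : 0 ≤ c) : ∃ y, c = star y * y :=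
  CStarAlgebra.nonneg_iff_eq_star_mul_self.mp hc

theorem CStarMatrix.star_mul_self_apply {n : ℕ} {C : Type*} [NonUnitalSemiring C] [StarRing C]
    (Y : CStarMatrix (Fin n) (Fin n) C) (i j : Fin n) :
    (star Y * Y) i j = ∑ l, star (Y l i) * Y l j := by
  rw [CStarMatrix.mul_apply]
  rfl

/-- Gram matrices over a C⋆-algebra are nonnegative. -/
theorem CStarMatrix.gram_nonneg {n : ℕ} {ι : Type*} [Fintype ι] (z : ι → Fin n → A)
    {N : CStarMatrix (Fin n) (Fin n) A} (hN : ∀ i j, N i j = ∑ l, star (z l i) * z l j) :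
    0 ≤ N := by
  -- `C l` has all `n` rows equal to `z l`, so `star (C l) * C l` is `n` times the wanted rank-one
  -- term; the factor `n⁻¹` corrects this.
  let C (l : ι) : CStarMatrix (Fin n) (Fin n) A := CStarMatrix.ofMatrix (Matrix.of fun _ j => z l j)
  have h : N = ∑ l, (n : ℂ)⁻¹ • (star (C l) * C l) := by
    ext i j
    have hn : (n : ℂ) ≠ 0 := by have := i.pos; exact_mod_cast this.ne'
    rw [hN, CStarMatrix.sum_apply]
    refine Finset.sum_congr rfl fun l _ => ?_
    rw [CStarMatrix.smul_apply, CStarMatrix.star_mul_self_apply]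
    change _ = (n : ℂ)⁻¹ • ∑ _ : Fin n, star (z l i) * z l j
    rw [Finset.sum_const, Finset.card_univ, Fintype.card_fin, ← Nat.cast_smul_eq_nsmul ℂ, smul_smul,
      inv_mul_cancel₀ hn, one_smul]
  rw [h]
  exact Finset.sum_nonneg fun l _ => smul_nonneg (inv_natCast_nonneg n) (star_mul_self_nonneg _)

theorem CStarMatrix.exists_gram_of_nonneg {n : ℕ} {N : CStarMatrix (Fin n) (Fin n) A}
    (hN : 0 ≤ N) : ∃ z : Fin n → Fin n → A, ∀ i j, N i j = ∑ l, star (z l i) * z l j := by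
  obtain ⟨Y, rfl⟩ := exists_eq_star_mul_self_of_nonneg hN
  exact ⟨fun l i => Y l i, CStarMatrix.star_mul_self_apply Y⟩

/-- A matrix of complex matrices whose entries form a Gram matrix is nonnegative. -/
theorem CStarMatrix.nested_gram_nonneg {n k : ℕ} {ι : Type*} [Fintype ι]
    (c : ι → Fin n → Fin k → ℂ)
    {N : CStarMatrix (Fin n) (Fin n) (CStarMatrix (Fin k) (Fin k) ℂ)}
    (hN : ∀ i j s t, N i j s t = ∑ x, star (c x i s) * c x j t) : 0 ≤ N := by
  -- The same device with `k` equal rows produces the factor `k`.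
  let D (x : ι) (j : Fin n) : CStarMatrix (Fin k) (Fin k) ℂ :=
    CStarMatrix.ofMatrix (Matrix.of fun _ t => c x j t)
  have h1 : 0 ≤ (k : ℂ) • N := CStarMatrix.gram_nonneg D fun i j => by
    ext s t
    rw [CStarMatrix.sum_apply]
    change (k : ℂ) * N i j s t = _
    rw [hN, Finset.mul_sum]
    refine Finset.sum_congr rfl fun x _ => ?_
    rw [CStarMatrix.mul_apply]
    change _ = ∑ _ : Fin k, star (c x i s) * c x j t
    simp
  have h2 : N = (k : ℂ)⁻¹ • (k : ℂ) • N := by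
    ext i j s t
    have hk : (k : ℂ) ≠ 0 := by have := s.pos; exact_mod_cast this.ne'
    rw [smul_smul, inv_mul_cancel₀ hk, one_smul]
  rw [h2]
  exact smul_nonneg (inv_natCast_nonneg k) h1

/-- The Kadison–Schwarz inequality. -/
theorem CompletelyPositiveMap.star_apply_mul_apply_le (φ : CompletelyPositiveMap A B)
    (h1 : φ 1 = 1) (a : A) : star (φ a) * φ a ≤ φ (star a * a) := by
  -- This is the Gram matrix of the pair `(1, a)`. Writing its image as a Gram matrix of vectors `z
  -- l`, the defect `φ(a⋆a) - φ(a)⋆φ(a)` is the sum of the squares of `z l 1 - z l 0 * φ a`, because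
  -- `∑ star (z l 0) * z l 0 = φ 1 = 1`.
  have hM : (0 : CStarMatrix (Fin 2) (Fin 2) A) ≤
      CStarMatrix.ofMatrix !![1, a; star a, star a * a] :=
    CStarMatrix.gram_nonneg (ι := Unit) (fun _ => ![1, a]) fun i j => by
      fin_cases i <;> fin_cases j <;> simp
  obtain ⟨z, hz⟩ := CStarMatrix.exists_gram_of_nonneg (φ.map_cstarMatrix_nonneg' 2 _ hM)
  have h00 := hz 0 0
  have h01 := hz 0 1
  have h11 := hz 1 1
  have e00 : φ 1 = ∑ l, star (z l 0) * z l 0 := h00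
  have e01 : φ a = ∑ l, star (z l 0) * z l 1 := h01
  have e11 : φ (star a * a) = ∑ l, star (z l 1) * z l 1 := h11
  rw [h1] at e00
  have e10 : star (φ a) = ∑ l, star (z l 1) * z l 0 := by rw [e01]; simp
  have key : φ (star a * a) - star (φ a) * φ a =
      ∑ l, star (z l 1 - z l 0 * φ a) * (z l 1 - z l 0 * φ a) := by
    have : ∀ l, star (z l 1 - z l 0 * φ a) * (z l 1 - z l 0 * φ a) =
        star (z l 1) * z l 1 - star (z l 1) * z l 0 * φ a - star (φ a) * (star (z l 0) * z l 1) +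
          star (φ a) * (star (z l 0) * z l 0) * φ a := fun l => by
      rw [star_sub, star_mul]; noncomm_ring
    simp_rw [this]
    rw [Finset.sum_add_distrib, Finset.sum_sub_distrib, Finset.sum_sub_distrib, ← Finset.sum_mul,
      ← Finset.mul_sum, ← Finset.sum_mul, ← Finset.mul_sum, ← e00, ← e01, ← e10, ← e11, mul_one]
    abel
  rw [← sub_nonneg, key]
  exact Finset.sum_nonneg fun l _ => star_mul_self_nonneg _

/-- Positivity bounds `φ` on `star a * a` by `‖φ 1‖ = 1` times the norm, and Kadison–Schwarz carries
this over to `φ a`. -/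
theorem CompletelyPositiveMap.norm_apply_le_of_map_one (φ : CompletelyPositiveMap A B)
    (h1 : φ 1 = 1) (a : A) : ‖φ a‖ ≤ ‖a‖ := by
  nontriviality B
  have h2 : ‖φ (star a * a)‖ ≤ ‖star a * a‖ := by
    have := PositiveLinearMap.norm_apply_le_of_nonneg (.ofClass φ : A →ₚ[ℂ] B) (star a * a)
      (star_mul_self_nonneg a)
    have h3 : ‖φ (star a * a)‖ ≤ ‖φ 1‖ * ‖star a * a‖ := this
    rwa [h1, norm_one, one_mul] at h3
  rw [CStarRing.norm_star_mul_self] at h2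
  have h3 := CStarAlgebra.norm_le_norm_of_nonneg_of_le (star_mul_self_nonneg (φ a))
    (φ.star_apply_mul_apply_le h1 a)
  rw [CStarRing.norm_star_mul_self] at h3
  exact (mul_self_le_mul_self_iff (norm_nonneg _) (norm_nonneg _)).mpr (h3.trans h2)

/-- The compression `a ↦ [τ(w_s⋆ a w_t)]` of a positive functional. -/
def compressionMap (τ : A →ₗ[ℂ] ℂ) (hτ : ∀ a, 0 ≤ τ (star a * a)) {k : ℕ} (w : Fin k → A) :
    CompletelyPositiveMap A (CStarMatrix (Fin k) (Fin k) ℂ) where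
  toFun a := CStarMatrix.ofMatrix (Matrix.of fun s t => τ (star (w s) * a * w t))
  map_add' a b := by
    ext s t
    exact (congrArg τ (by rw [mul_add, add_mul])).trans (map_add τ _ _)
  map_smul' c a := by
    ext s t
    exact (congrArg τ (by rw [mul_smul_comm, smul_mul_assoc])).trans (map_smul τ c _)
  map_cstarMatrix_nonneg' n M hM := by
    obtain ⟨z, hz⟩ := CStarMatrix.exists_gram_of_nonneg hM
    -- For each `l` the scalar matrix indexed by pairs `(j, t)` is positive semidefinite, its
    -- quadratic form being `τ` of a square. Its rank-one decomposition supplies the scalar Gram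
    -- vectors.
    have hG (l : Fin n) : ∃ (m : ℕ) (C : Fin m → Fin n × Fin k → ℂ), ∀ p r,
        τ (star (z l p.1 * w p.2) * (z l r.1 * w r.2)) =
          ∑ e, star (C e p) * C e r := by
      have hps : (Matrix.of fun p r : Fin n × Fin k =>
          τ (star (z l p.1 * w p.2) * (z l r.1 * w r.2))).PosSemidef := by
        have hq (y : Fin n × Fin k → ℂ) : star y ⬝ᵥ ((Matrix.of fun p r : Fin n × Fin k =>
            τ (star (z l p.1 * w p.2) * (z l r.1 * w r.2))).mulVec y) =
            τ (star (∑ p, y p • (z l p.1 * w p.2)) * ∑ p, y p • (z l p.1 * w p.2)) := by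
          rw [star_sum, Finset.sum_mul_sum, map_sum]
          refine Finset.sum_congr rfl fun p _ => ?_
          rw [map_sum, Matrix.mulVec, dotProduct, Finset.mul_sum]
          refine Finset.sum_congr rfl fun r _ => ?_
          rw [star_smul, smul_mul_smul_comm, map_smul, smul_eq_mul, Matrix.of_apply, Pi.star_apply]
          ring
        have hstar : ∀ a b, star (τ (star a * b)) = τ (star b * a) := by
          let f : A →ₚ[ℂ] ℂ := PositiveLinearMap.mk₀ τ fun a ha => by
            obtain ⟨b, rfl⟩ := CStarAlgebra.nonneg_iff_eq_star_mul_self.mp ha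
            exact hτ b
          intro a b
          have : f (star (star a * b)) = star (f (star a * b)) := map_star f _
          rw [star_mul, star_star] at this
          exact this.symm
        refine .of_dotProduct_mulVec_nonneg ?_ fun y => ?_
        · ext p r
          exact hstar _ _
        · rw [hq]; exact hτ _
      obtain ⟨m, c, hc⟩ := Matrix.posSemidef_iff_eq_sum_vecMulVec.mp hps
      refine ⟨m, fun e p => star (c e p), fun p r => ?_⟩
      have := congrFun (congrFun hc p) r
      simpa [Matrix.sum_apply, Matrix.vecMulVec_apply] using this
    choose m C hC using hG
    refine CStarMatrix.nested_gram_nonneg (ι := Σ l, Fin (m l))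
      (fun x j t => C x.1 x.2 (j, t)) fun i j s t => ?_
    rw [Fintype.sum_sigma]
    change τ (star (w s) * M i j * w t) = _
    rw [hz, Finset.mul_sum, Finset.sum_mul, map_sum]
    refine Finset.sum_congr rfl fun l _ => ?_
    rw [← hC l (i, s) (j, t), star_mul]
    simp only [mul_assoc]

/-- The map `M ↦ ∑ M_{st} x_s x_t⋆`. -/
def dilationMap {k : ℕ} (x : Fin k → A) :
    CompletelyPositiveMap (CStarMatrix (Fin k) (Fin k) ℂ) A where
  toFun M := ∑ s, ∑ t, M s t • (x s * star (x t))
  map_add' a b := by simp [add_smul, Finset.sum_add_distrib]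
  map_smul' c a := by simp [Finset.smul_sum, smul_smul]
  map_cstarMatrix_nonneg' n P hP := by
    obtain ⟨Y, hY⟩ := CStarMatrix.exists_gram_of_nonneg hP
    refine CStarMatrix.gram_nonneg (ι := Fin n × Fin k)
      (fun p i => ∑ s, Y p.1 i p.2 s • star (x s)) fun i j => ?_
    have h1 (s t : Fin k) : P i j s t =
        ∑ p : Fin n × Fin k, star (Y p.1 i p.2 s) * Y p.1 j p.2 t := by
      rw [hY, CStarMatrix.sum_apply, Fintype.sum_prod_type]
      simp [CStarMatrix.mul_apply, CStarMatrix.star_apply]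
    change ∑ s, ∑ t, P i j s t • (x s * star (x t)) = _
    simp_rw [h1, Finset.sum_smul, star_sum, Finset.sum_mul_sum, star_smul, star_star,
      smul_mul_smul_comm]
    rw [Finset.sum_comm (s := (Finset.univ : Finset (Fin n × Fin k)))]
    exact Finset.sum_congr rfl fun s _ => Finset.sum_comm

end CompletePositivity

/-! ### Nuclearity through Følner boxes in `ℤ²`. -/

section Nuclear

open Filter Topology

variable {A : Type*} [CStarAlgebra A]

theorem star_unitaryMonomial_mul_self (u v : unitary A) (a : ℤ × ℤ) :
    star (unitaryMonomial u v a) * unitaryMonomial u v a = 1 :=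
  Unitary.star_mul_self_of_mem (u ^ a.1 * v ^ a.2).2

theorem unitaryMonomial_mul_star_self (u v : unitary A) (a : ℤ × ℤ) :
    unitaryMonomial u v a * star (unitaryMonomial u v a) = 1 :=
  Unitary.mul_star_self_of_mem (u ^ a.1 * v ^ a.2).2

namespace IsRotationPair

variable {q : Circle} {u v : unitary A} (h : IsRotationPair q u v)

include h

theorem trace_star_mul {τ : A →L[ℂ] ℂ} (hτ : IsCanonicalTrace u v τ) (s t : ℤ × ℤ) :
    τ (star (unitaryMonomial u v s) * unitaryMonomial u v t) = if s = t then 1 else 0 := by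
  split_ifs with hst
  · rw [hst, star_unitaryMonomial_mul_self]
    exact hτ.isTracialState.map_one
  · rw [h.star_unitaryMonomial, smul_mul_assoc, h.unitaryMonomial_mul, map_smul, map_smul,
      hτ.apply_monomial, if_neg, smul_zero, smul_zero]
    rw [neg_add_eq_zero]
    exact hst

/-- Distinct monomials are `τ`-orthogonal, so only `r + t = s` contributes. There `w_r w_t` is a
phase times `w_s`, and multiplying by `star w_t` absorbs the phase and leaves `w_r`. -/
theorem trace_compression {τ : A →L[ℂ] ℂ} (hτ : IsCanonicalTrace u v τ) (r s t : ℤ × ℤ) :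
    τ (star (unitaryMonomial u v s) * unitaryMonomial u v r * unitaryMonomial u v t) •
      (unitaryMonomial u v s * star (unitaryMonomial u v t)) =
      if r + t = s then unitaryMonomial u v r else 0 := by
  rw [mul_assoc, h.unitaryMonomial_mul, mul_smul_comm, map_smul, h.trace_star_mul hτ]
  by_cases hs : r + t = s
  · subst hs
    rw [if_pos rfl, if_pos rfl, smul_eq_mul, mul_one, ← smul_mul_assoc, ← h.unitaryMonomial_mul,
      mul_assoc, unitaryMonomial_mul_star_self, mul_one]
  · rw [if_neg hs, if_neg (fun h => hs h.symm), smul_zero, zero_smul]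

end IsRotationPair

variable [PartialOrder A] [StarOrderedRing A]

theorem compressionMap_apply (τ : A →ₗ[ℂ] ℂ) (hτ : ∀ a, 0 ≤ τ (star a * a)) {k : ℕ}
    (w : Fin k → A) (a : A) (s t : Fin k) :
    compressionMap τ hτ w a s t = τ (star (w s) * a * w t) := rfl

theorem dilationMap_apply {k : ℕ} (x : Fin k → A) (M : CStarMatrix (Fin k) (Fin k) ℂ) :
    dilationMap x M = ∑ s, ∑ t, M s t • (x s * star (x t)) := rfl

/-- The box `[0, N)²`. -/
def integerBox (N : ℕ) : Finset (ℤ × ℤ) := Finset.Ico 0 (N : ℤ) ×ˢ Finset.Ico 0 (N : ℤ)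

theorem card_integerBox (N : ℕ) : (integerBox N).card = N * N := by
  simp [integerBox]

theorem card_integerBox_shift (N : ℕ) (r : ℤ × ℤ) (h1 : |r.1| ≤ N) (h2 : |r.2| ≤ N) :
    ((((integerBox N).filter fun t => r + t ∈ integerBox N).card : ℕ) : ℝ) =
      (N - |(r.1 : ℝ)|) * (N - |(r.2 : ℝ)|) := by
  have hI (m : ℤ) (hm : |m| ≤ N) :
      (((Finset.Ico (max 0 (-m)) (min (N : ℤ) (N - m))).card : ℕ) : ℝ) = N - |(m : ℝ)| := by
    rw [Int.card_Ico]
    have h : min (N : ℤ) (N - m) - max 0 (-m) = N - |m| := by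
      rcases le_total 0 m with h | h
      · rw [abs_of_nonneg h, min_eq_right (by omega), max_eq_left (by omega), sub_zero]
      · rw [abs_of_nonpos h, min_eq_left (by omega), max_eq_right (by omega)]
    rw [h]
    have h' : (((N - |m|).toNat : ℤ) : ℝ) = ((N - |m| : ℤ) : ℝ) := by
      rw [Int.toNat_of_nonneg (by omega)]
    push_cast at h'
    exact h'
  have hs : (integerBox N).filter (fun t => r + t ∈ integerBox N) =
      Finset.Ico (max 0 (-r.1)) (min (N : ℤ) (N - r.1)) ×ˢ
        Finset.Ico (max 0 (-r.2)) (min (N : ℤ) (N - r.2)) := by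
    ext ⟨i, j⟩
    simp only [integerBox, Finset.mem_filter, Finset.mem_product, Finset.mem_Ico, Prod.fst_add,
      Prod.snd_add, max_le_iff, lt_min_iff]
    constructor <;> intro h <;> omega
  rw [hs, Finset.card_product, Nat.cast_mul, hI _ h1, hI _ h2]

theorem tendsto_card_integerBox_shift (r : ℤ × ℤ) :
    Tendsto (fun N : ℕ => ((((integerBox N).filter fun t => r + t ∈ integerBox N).card : ℕ) : ℝ) /
      (integerBox N).card) atTop (𝓝 1) := by
  have h (m : ℤ) : Tendsto (fun N : ℕ => 1 - |(m : ℝ)| / (N : ℝ)) atTop (𝓝 1) := by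
    simpa using (tendsto_const_div_atTop_nhds_zero_nat |(m : ℝ)|).const_sub 1
  have h12 := (h r.1).mul (h r.2)
  rw [mul_one] at h12
  refine h12.congr' ?_
  -- The threshold makes `N` exceed both coordinates of `r` in absolute value, and the `+ 1` keeps
  -- `N` nonzero.
  filter_upwards [eventually_ge_atTop (|r.1|.toNat + |r.2|.toNat + 1)] with N hN
  rw [card_integerBox_shift N r (by omega) (by omega), card_integerBox]
  have hN0 : (N : ℝ) ≠ 0 := by exact_mod_cast (by omega : N ≠ 0)
  push_cast
  field_simp

namespace IsRotationPair

variable {q : Circle} {u v : unitary A} (h : IsRotationPair q u v)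

include h

/-- Compression is unital because the monomials are `τ`-orthonormal, and the normalized dilation is
unital because they are unitary; unital completely positive maps are contractive. Each `t ∈ s` with
`r + t ∈ s` contributes one copy of the monomial of index `r` to the composite. -/
theorem exists_cp_approximation {τ : A →L[ℂ] ℂ} (hτ : IsCanonicalTrace u v τ)
    (s : Finset (ℤ × ℤ)) (hs : s.Nonempty) :
    ∃ (φ : CompletelyPositiveMap A (CStarMatrix (Fin s.card) (Fin s.card) ℂ))
      (ψ : CompletelyPositiveMap (CStarMatrix (Fin s.card) (Fin s.card) ℂ) A),
      (∀ a, ‖φ a‖ ≤ ‖a‖) ∧ (∀ M, ‖ψ M‖ ≤ ‖M‖) ∧ ∀ r, ψ (φ (unitaryMonomial u v r)) =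
        (((((s.filter fun t => r + t ∈ s).card : ℕ) : ℝ) / s.card : ℝ) : ℂ) •
          unitaryMonomial u v r := by
  classical
  have hk : (s.card : ℝ) ≠ 0 := by exact_mod_cast hs.card_ne_zero
  let e := s.equivFin
  let w (i : Fin s.card) : A := unitaryMonomial u v (e.symm i)
  -- The normalization `1 / |s|` is split as `|s|^{-1/2}` on each of the two factors of `x_s x_t⋆`.
  let κ : ℂ := (((√(s.card : ℝ))⁻¹ : ℝ) : ℂ)
  have hκ : κ * star κ = ((s.card : ℝ)⁻¹ : ℝ) := by
    simp only [κ, Complex.star_def, Complex.conj_ofReal]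
    rw [← Complex.ofReal_mul, ← mul_inv, Real.mul_self_sqrt (by positivity)]
  have hψ (M : CStarMatrix (Fin s.card) (Fin s.card) ℂ) : dilationMap (fun i => κ • w i) M =
      (((s.card : ℝ)⁻¹ : ℝ) : ℂ) • ∑ i, ∑ j, M i j • (w i * star (w j)) := by
    rw [dilationMap_apply]
    simp_rw [star_smul, smul_mul_smul_comm, hκ, Finset.smul_sum, smul_smul, mul_comm]
  have hφ1 : compressionMap (τ : A →ₗ[ℂ] ℂ) hτ.isTracialState.nonneg w 1 = 1 := by
    ext i j
    rw [compressionMap_apply, mul_one, CStarMatrix.one_apply]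
    refine (h.trace_star_mul hτ _ _).trans ?_
    simp
  have hψ1 : dilationMap (fun i => κ • w i) 1 = 1 := by
    rw [hψ]
    have : ∀ i : Fin s.card, ∑ j, (1 : CStarMatrix (Fin s.card) (Fin s.card) ℂ) i j •
        (w i * star (w j)) = 1 := fun i => by
      rw [Finset.sum_eq_single i]
      · rw [CStarMatrix.one_apply_eq, one_smul]
        exact unitaryMonomial_mul_star_self u v _
      · intro j _ hj
        rw [CStarMatrix.one_apply_ne hj.symm, zero_smul]
      · simp
    rw [Finset.sum_congr rfl fun i _ => this i, Finset.sum_const, Finset.card_univ,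
      Fintype.card_fin, ← Nat.cast_smul_eq_nsmul ℂ, smul_smul]
    push_cast
    rw [inv_mul_cancel₀ (by exact_mod_cast hk), one_smul]
  refine ⟨compressionMap (τ : A →ₗ[ℂ] ℂ) hτ.isTracialState.nonneg w,
    dilationMap fun i => κ • w i, CompletelyPositiveMap.norm_apply_le_of_map_one _ hφ1,
    CompletelyPositiveMap.norm_apply_le_of_map_one _ hψ1, fun r => ?_⟩
  rw [hψ]
  have hterm (i j : Fin s.card) :
      compressionMap (τ : A →ₗ[ℂ] ℂ) hτ.isTracialState.nonneg w (unitaryMonomial u v r) i j •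
        (w i * star (w j)) = if r + e.symm j = e.symm i then unitaryMonomial u v r else 0 :=
    h.trace_compression hτ r _ _
  simp_rw [hterm]
  rw [Finset.sum_comm]
  have hcol (j : Fin s.card) :
      (∑ i, if r + e.symm j = e.symm i then unitaryMonomial u v r else 0) =
        if r + e.symm j ∈ s then unitaryMonomial u v r else 0 := by
    rw [e.symm.sum_comp (fun x : s => if r + e.symm j = x then unitaryMonomial u v r else 0)]
    rw [Finset.sum_coe_sort s
      (fun x => if r + (e.symm j : ℤ × ℤ) = x then unitaryMonomial u v r else 0), Finset.sum_ite_eq]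
  simp_rw [hcol]
  rw [e.symm.sum_comp (fun x : s => if r + x ∈ s then unitaryMonomial u v r else 0),
    Finset.sum_coe_sort s (fun x => if r + x ∈ s then unitaryMonomial u v r else 0),
    ← Finset.sum_filter, Finset.sum_const, ← Nat.cast_smul_eq_nsmul ℂ, smul_smul]
  congr 1
  push_cast
  ring

theorem isNuclear {τ : A →L[ℂ] ℂ} (hτ : IsCanonicalTrace u v τ) : CStarStructure.IsNuclear A := by
  have hne (N : ℕ) : (integerBox (N + 1)).Nonempty := by
    rw [← Finset.card_pos, card_integerBox]; positivity
  choose φ ψ hφ hψ hψφ using fun N => h.exists_cp_approximation hτ _ (hne N)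
  have hmono (r : ℤ × ℤ) : Tendsto (fun N => ψ N (φ N (unitaryMonomial u v r))) atTop
      (𝓝 (unitaryMonomial u v r)) := by
    have h1 := (Complex.continuous_ofReal.tendsto _).comp
      ((tendsto_card_integerBox_shift r).comp (tendsto_add_atTop_nat 1))
    have h2 := h1.smul_const (unitaryMonomial u v r)
    rw [Complex.ofReal_one, one_smul] at h2
    exact h2.congr fun N => (hψφ N r).symm
  obtain ⟨G, -, hG⟩ := exists_limit_of_dense_span
    (T := fun N => (ψ N).toLinearMap ∘ₗ (φ N).toLinearMap)
    (fun N a => (hψ N _).trans (hφ N a)) h.dense (by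
      rintro _ ⟨r, rfl⟩
      exact (hmono r).cauchySeq)
  have hGid : G = ContinuousLinearMap.id ℂ A :=
    h.clm_ext fun r => tendsto_nhds_unique (hG _) (hmono r)
  intro F ε hε
  have hF : ∀ᶠ N in atTop, ∀ a ∈ F, ‖ψ N (φ N a) - a‖ < ε := by
    rw [Filter.eventually_all_finset]
    intro a _
    have := hG a
    rw [hGid] at this
    simpa only [dist_eq_norm] using! Metric.tendsto_nhds.mp this ε hε
  obtain ⟨N, hN⟩ := hF.exists
  exact ⟨_, φ N, ψ N, hφ N, hψ N, hN⟩

end IsRotationPair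

end Nuclear

/-! ### A covariant representation on `ℓ²` of the discrete circle, and injectivity of `C(S¹) → A_θ`.
-/

section RegularRepresentation

open CStarDynamics RotationAlgebra

/-- Square-summable functions on the circle as a discrete set. -/
abbrev CircleL2 : Type := lp (fun _ : Circle => ℂ) 2

/-- Multiplication by a bounded function on the discrete `ℓ²` of the circle. -/
def circleMul (f : CircleFunctions) : CircleL2 →L[ℂ] CircleL2 :=
  LinearMap.mkContinuous
    { toFun := fun ξ => ⟨fun z => f z * ξ z, ((lp.memℓp ξ).const_mul (‖f‖ : ℂ)).mono' fun z => by
        simpa using mul_le_mul_of_nonneg_right (f.norm_coe_le_norm z) (norm_nonneg (ξ z))⟩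
      map_add' := fun ξ η => by ext z; exact mul_add _ _ _
      map_smul' := fun c ξ => by ext z; exact mul_left_comm _ _ _ }
    ‖f‖ fun ξ => by
      refine (lp.norm_mono (y := (‖f‖ : ℂ) • ξ) (by simp) fun z => ?_).trans_eq ?_
      · change ‖f z * ξ z‖ ≤ ‖(‖f‖ : ℂ) • ξ z‖
        simpa using mul_le_mul_of_nonneg_right (f.norm_coe_le_norm z) (norm_nonneg (ξ z))
      · rw [norm_smul]
        simp

theorem circleMul_apply (f : CircleFunctions) (ξ : CircleL2) (z : Circle) :
    circleMul f ξ z = f z * ξ z := rfl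

/-- Multiplication operators as a representation of `C(S¹)`. -/
def circleMulHom : CircleFunctions →⋆ₐ[ℂ] (CircleL2 →L[ℂ] CircleL2) where
  toFun := circleMul
  map_one' := by ext ξ z; simp [circleMul_apply]
  map_mul' f g := by ext ξ z; exact mul_assoc _ _ _
  map_zero' := by ext ξ z; simp [circleMul_apply]
  map_add' f g := by ext ξ z; exact add_mul _ _ _
  commutes' c := by ext ξ z; rfl
  map_star' f := by
    rw [ContinuousLinearMap.star_eq_adjoint, ContinuousLinearMap.eq_adjoint_iff]
    intro ξ η
    rw [lp.inner_eq_tsum, lp.inner_eq_tsum]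
    refine tsum_congr fun z => ?_
    rw [circleMul_apply, circleMul_apply]
    simp [mul_assoc, mul_left_comm]

/-- Permutation of the coordinates. -/
def circlePerm (e : Equiv.Perm Circle) : CircleL2 ≃ₗᵢ[ℂ] CircleL2 where
  toFun ξ := ⟨fun z => ξ (e z),
    memℓp_gen (((lp.memℓp ξ).summable (by simp)).comp_injective e.injective)⟩
  invFun ξ := ⟨fun z => ξ (e.symm z),
    memℓp_gen (((lp.memℓp ξ).summable (by simp)).comp_injective e.symm.injective)⟩
  map_add' ξ η := rfl
  map_smul' c ξ := rfl
  left_inv ξ := by ext z; exact congrArg ξ (e.apply_symm_apply z)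
  right_inv ξ := by ext z; exact congrArg ξ (e.symm_apply_apply z)
  norm_map' ξ := by
    rw [lp.norm_eq_tsum_rpow (by simp), lp.norm_eq_tsum_rpow (by simp)]
    congr 1
    exact e.tsum_eq fun z => ‖ξ z‖ ^ (2 : ENNReal).toReal

theorem circlePerm_apply (e : Equiv.Perm Circle) (ξ : CircleL2) (z : Circle) :
    circlePerm e ξ z = ξ (e z) := rfl

/-- The unitary representation of `ℤ` by rotations. -/
def circleRotation (θ : ℝ) : Multiplicative ℤ →* (CircleL2 ≃ₗᵢ[ℂ] CircleL2) where
  toFun n := circlePerm (Equiv.mulLeft (Circle.exp (-(2 * Real.pi * (n.toAdd : ℝ) * θ))))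
  map_one' := by ext ξ z; simp [circlePerm_apply]
  map_mul' m n := by
    ext ξ z
    change ξ _ = ξ _
    simp only [Equiv.coe_mulLeft]
    rw [← mul_assoc, ← Circle.exp_add, toAdd_mul]
    exact congrArg (fun t : ℝ => ξ (Circle.exp t * z)) (by push_cast; ring)

/-- The covariant representation of the rotation action on the discrete `ℓ²` of the circle. -/
def circleCovariantRep (θ : ℝ) : CovariantRep (rotationAction θ) CircleL2 where
  π := circleMulHom
  ρ := (Unitary.linearIsometryEquiv (𝕜 := ℂ) (H := CircleL2)).symm.toMonoidHom.comp
    (circleRotation θ)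
  covariant n f := by
    set W := (Unitary.linearIsometryEquiv (𝕜 := ℂ) (H := CircleL2)).symm (circleRotation θ n)
    change (W : CircleL2 →L[ℂ] CircleL2) * circleMul f * star (W : CircleL2 →L[ℂ] CircleL2) =
      circleMul (rotationAction θ n f)
    have h : (W : CircleL2 →L[ℂ] CircleL2) * circleMul f =
        circleMul (rotationAction θ n f) * (W : CircleL2 →L[ℂ] CircleL2) := by
      ext ξ z
      rfl
    rw [h, mul_assoc, Unitary.mul_star_self_of_mem W.2, mul_one]

theorem circleMul_injective : Function.Injective circleMul := by
  intro f g hfg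
  ext z
  classical
  -- Applying both operators to the point mass at `z` and evaluating at `z` recovers the values of
  -- the functions.
  have h := congrArg (fun ξ : CircleL2 => ξ z)
    (DFunLike.congr_fun hfg (lp.single 2 z (1 : ℂ) : CircleL2))
  simpa [circleMul_apply] using h

/-- The universal norm dominates the operator norm in the covariant representation above, where `f`
acts as multiplication by `f`. -/
theorem circleHom_injective (θ : ℝ) : Function.Injective (circleHom θ) := by
  rw [injective_iff_map_eq_zero]
  intro f hf
  have h1 : AlgCrossedProduct.maxNorm (AlgCrossedProduct.single (rotationAction θ) 1 f) = 0 := by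
    rw [← CrossedProduct.norm_ofAlg]
    exact norm_eq_zero.mpr hf
  have h2 := AlgCrossedProduct.norm_integrated_le (circleCovariantRep θ)
    (AlgCrossedProduct.single (rotationAction θ) 1 f)
  rw [h1, norm_le_zero_iff, CovariantRep.integrated_single, map_one] at h2
  have h3 : circleMul f = 0 := by
    simpa only [Submonoid.coe_one, mul_one, map_one, OneMemClass.coe_one] using! h2
  exact circleMul_injective (h3.trans circleMulHom.map_zero'.symm)

end RegularRepresentation

/-! ### `U` and `V` form a rotation pair, and `C*(U)` is the image of `C(S¹)`. -/

section Monomials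

open CStarDynamics RotationAlgebra Filter Topology

/-- Stone–Weierstrass: the coordinate alone separates points. -/
theorem elemental_circleCoordinate :
    StarAlgebra.elemental ℂ (circleCoordinate : CircleFunctions) = ⊤ := by
  rw [StarAlgebra.elemental]
  refine ContinuousMap.starSubalgebra_topologicalClosure_eq_top_of_separatesPoints _ ?_
  intro x y hxy
  exact ⟨_, ⟨_, StarAlgebra.self_mem_adjoin_singleton ℂ _, rfl⟩,
    fun h => hxy (Circle.coe_injective h)⟩

theorem circleHom_isometry (θ : ℝ) : Isometry (circleHom θ) :=
  NonUnitalStarAlgHom.isometry (circleHom θ) (circleHom_injective θ)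

/-- An injective `⋆`-homomorphism is isometric, hence closed, so it carries the closure of the
algebra generated by `z` onto the closure of the algebra generated by `U`. -/
theorem circleHom_range (θ : ℝ) :
    (circleHom θ).range = StarAlgebra.elemental ℂ (U θ : rotationAlgebra θ) := by
  rw [StarAlgHom.range_eq_map_top, ← elemental_circleCoordinate, StarAlgebra.elemental,
    ← StarSubalgebra.topologicalClosure_map _ _
      (circleHom_isometry θ).isClosedEmbedding.isClosedMap (circleHom_isometry θ).continuous,
    StarAlgHom.map_adjoin, Set.image_singleton]
  rfl

theorem monomial_eq (θ : ℝ) (m n : ℤ) : monomial θ m n = unitaryMonomial (U θ) (V θ) (m, n) := rfl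

theorem V_zpow (θ : ℝ) (n : ℤ) : V θ ^ n =
    CrossedProduct.groupUnitary (rotationAction θ) (Multiplicative.ofAdd (-n)) := by
  rw [V, ← map_zpow, ← ofAdd_zsmul]
  simp

theorem V_mul_U (θ : ℝ) : (V θ : rotationAlgebra θ) * U θ =
    ((Circle.exp (2 * Real.pi * θ) : Circle) : ℂ) • ((U θ : rotationAlgebra θ) * V θ) := by
  -- The index `-1` in `V` cancels the minus sign in the rotation action, which gives `q =
  -- e^{2πiθ}`.
  have h1 : rotationAction θ (Multiplicative.ofAdd (-1)) circleCoordinate =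
      ((Circle.exp (2 * Real.pi * θ) : Circle) : ℂ) • (circleCoordinate : CircleFunctions) := by
    ext z
    rw [rotationAction_apply]
    change ((Circle.exp _ * z : Circle) : ℂ) =
      ((Circle.exp (2 * Real.pi * θ) : Circle) : ℂ) * (z : ℂ)
    rw [Circle.coe_mul]
    congr 3
    push_cast
    ring
  have h : (V θ : rotationAlgebra θ) * U θ * star (V θ : rotationAlgebra θ) =
      circleHom θ (rotationAction θ (Multiplicative.ofAdd (-1)) circleCoordinate) :=
    CrossedProduct.groupUnitary_covariant (rotationAction θ) (Multiplicative.ofAdd (-1))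
      (circleCoordinate : CircleFunctions)
  rw [h1, map_smul] at h
  calc (V θ : rotationAlgebra θ) * U θ
      = (V θ : rotationAlgebra θ) * U θ * star (V θ : rotationAlgebra θ) * V θ := by
        rw [mul_assoc _ (star _), Unitary.star_mul_self_of_mem (V θ).2, mul_one]
    _ = _ := by rw [h, smul_mul_assoc]; rfl

theorem isRotationPair (θ : ℝ) : IsRotationPair (Circle.exp (2 * Real.pi * θ)) (U θ) (V θ) := by
  refine ⟨V_mul_U θ, ?_⟩
  -- The closure of the monomial span is a C⋆-algebra containing `U`, hence the image of `C(S¹)`,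
  -- and containing all `u_g = V^{-g}`; so it contains every `f u_g`.
  set K := (monomialSubalgebra (V_mul_U θ)).topologicalClosure
  have hmono (a : ℤ × ℤ) : unitaryMonomial (U θ) (V θ) a ∈ K :=
    subset_closure (Submodule.subset_span ⟨a, rfl⟩)
  have hU : (U θ : rotationAlgebra θ) ∈ K := by
    simpa [unitaryMonomial] using hmono (1, 0)
  have hcirc (f : CircleFunctions) : circleHom θ f ∈ K := by
    have h1 : circleHom θ f ∈ (circleHom θ).range := ⟨f, rfl⟩
    rw [circleHom_range] at h1
    exact StarAlgebra.elemental.le_of_mem isClosed_closure hU h1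
  have hgrp (g : Multiplicative ℤ) :
      (CrossedProduct.groupUnitary (rotationAction θ) g : rotationAlgebra θ) ∈ K := by
    have h1 := hmono (0, -g.toAdd)
    rw [unitaryMonomial, zpow_zero, one_mul, V_zpow, neg_neg] at h1
    exact h1
  rw [dense_iff_closure_eq, Set.eq_univ_iff_forall]
  intro x
  change x ∈ K
  induction x using CrossedProduct.induction with
  | hp => exact isClosed_closure
  | h a =>
    induction a using AlgCrossedProduct.induction with
    | zero => rw [map_zero]; exact zero_mem K
    | single g f =>
      have h1 : AlgCrossedProduct.single (rotationAction θ) g f =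
          AlgCrossedProduct.single (rotationAction θ) 1 f *
            AlgCrossedProduct.single (rotationAction θ) g 1 := by
        rw [AlgCrossedProduct.single_mul_single, one_mul, map_one, mul_one]
      rw [h1, map_mul]
      exact mul_mem (hcirc f) (hgrp g)
    | add x y hx hy => rw [map_add]; exact add_mem hx hy

end Monomials

/-! ### The Cartan property of `C*(u)`. -/

section Cartan

open Filter Topology

variable {A : Type*} [CStarAlgebra A]

theorem conjStarAlgAut_pow_of_commute {w : unitary A} {a : A} (h : (w : A) * a = a * w) (k : ℕ) :
    Unitary.conjStarAlgAut ℂ A (w ^ k) a = a := by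
  have h1 : Unitary.conjStarAlgAut ℂ A w a = (1 : ℂ) • a := by
    rw [Unitary.conjStarAlgAut_apply, h, mul_assoc, Unitary.mul_star_self_of_mem w.2, mul_one,
      one_smul]
  simpa using conjStarAlgAut_pow_of_eigen h1 k

theorem commute_of_mem_elemental {u : unitary A} {x y : A}
    (hx : x ∈ StarAlgebra.elemental ℂ (u : A)) (hy : y ∈ StarAlgebra.elemental ℂ (u : A)) :
    x * y = y * x :=
  congrArg Subtype.val (mul_comm (⟨x, hx⟩ : StarAlgebra.elemental ℂ (u : A)) ⟨y, hy⟩)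

namespace IsAverageLimit

variable {w : unitary A} {E : A →L[ℂ] A} (hE : IsAverageLimit w E)

include hE

theorem apply_of_commute {a : A} (h : (w : A) * a = a * w) : E a = a :=
  tendsto_nhds_unique (hE.tendsto a)
    (tendsto_const_nhds.congr fun n => (unitaryAverage_eq_self h n).symm)

theorem apply_mul_left {d : A} (h : (w : A) * d = d * w) (a : A) : E (d * a) = d * E a := by
  refine tendsto_nhds_unique (hE.tendsto _) (((hE.tendsto a).const_mul d).congr fun n => ?_)
  simp_rw [unitaryAverage_apply, map_mul, conjStarAlgAut_pow_of_commute h]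
  rw [mul_smul_comm, Finset.mul_sum]

theorem apply_mul_right {d : A} (h : (w : A) * d = d * w) (a : A) : E (a * d) = E a * d := by
  refine tendsto_nhds_unique (hE.tendsto _) (((hE.tendsto a).mul_const d).congr fun n => ?_)
  simp_rw [unitaryAverage_apply, map_mul, conjStarAlgAut_pow_of_commute h]
  rw [smul_mul_assoc, Finset.sum_mul]

end IsAverageLimit

/-- The preimage of `C*(u)` under conjugation is a closed `⋆`-subalgebra, so only the generator has
to be tested. -/
theorem conj_mem_elemental {u w : unitary A}
    (h : (w : A) * u * star (w : A) ∈ StarAlgebra.elemental ℂ (u : A)) {d : A}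
    (hd : d ∈ StarAlgebra.elemental ℂ (u : A)) :
    (w : A) * d * star (w : A) ∈ StarAlgebra.elemental ℂ (u : A) := by
  let φ : A →⋆ₐ[ℂ] A := (Unitary.conjStarAlgAut ℂ A w : A →⋆ₐ[ℂ] A)
  have hφ : Continuous φ := by
    have : Continuous fun x : A => (w : A) * x * star (w : A) := by fun_prop
    exact this
  have hle : StarAlgebra.elemental ℂ (u : A) ≤ (StarAlgebra.elemental ℂ (u : A)).comap φ :=
    StarAlgebra.elemental.le_of_mem ((StarAlgebra.elemental.isClosed ℂ (u : A)).preimage hφ) h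
  exact hle hd

namespace IsRotationPair

variable {q : Circle} {u v : unitary A} (h : IsRotationPair q u v)

include h

theorem separableSpace : TopologicalSpace.SeparableSpace A := by
  rw [← TopologicalSpace.isSeparable_univ_iff, ← h.dense.closure_eq]
  exact ((Set.countable_range _).isSeparable.span (R := ℂ)).closure

theorem monomial_mul_u (a : ℤ × ℤ) : unitaryMonomial u v a * u =
    ((q ^ a.2 : Circle) : ℂ) • ((u : A) * unitaryMonomial u v a) := by
  have hu : (u : A) = unitaryMonomial u v (1, 0) := by simp [unitaryMonomial]
  rw [hu, h.unitaryMonomial_mul, h.unitaryMonomial_mul, smul_smul, add_comm a]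
  simp

/-- Conjugation by a monomial, or by its adjoint, multiplies `u` by a phase. -/
theorem monomial_mem_normalizer (a : ℤ × ℤ) : unitaryMonomial u v a ∈
    CStarStructure.normalizer (StarAlgebra.elemental ℂ (u : A)).toNonUnitalStarSubalgebra := by
  set w : unitary A := u ^ a.1 * v ^ a.2
  have hu : (u : A) ∈ StarAlgebra.elemental ℂ (u : A) := StarAlgebra.elemental.self_mem ℂ _
  have hw : (w : A) * u = ((q ^ a.2 : Circle) : ℂ) • ((u : A) * w) := h.monomial_mul_u a
  have h1 : (w : A) * u * star (w : A) = ((q ^ a.2 : Circle) : ℂ) • (u : A) := by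
    rw [hw, smul_mul_assoc, mul_assoc, Unitary.mul_star_self_of_mem w.2, mul_one]
  have h2 : star (w : A) * u * w = ((q ^ a.2 : Circle) : ℂ)⁻¹ • (u : A) := by
    rw [eq_inv_smul_iff₀ (Circle.coe_ne_zero _), mul_assoc, ← mul_smul_comm, ← hw, ← mul_assoc,
      Unitary.star_mul_self_of_mem w.2, one_mul]
  intro d hd
  refine ⟨conj_mem_elemental (w := w) (by rw [h1]; exact SMulMemClass.smul_mem _ hu) hd, ?_⟩
  have h3 := conj_mem_elemental (w := star w) (u := u) (d := d)
    (by rw [Unitary.coe_star, star_star, h2]; exact SMulMemClass.smul_mem _ hu) hd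
  rw [Unitary.coe_star, star_star] at h3
  exact h3

theorem isRegular : CStarStructure.IsRegular
    (StarAlgebra.elemental ℂ (u : A)).toNonUnitalStarSubalgebra := by
  rw [CStarStructure.IsRegular, eq_top_iff]
  intro x _
  set K := (NonUnitalStarAlgebra.adjoin ℂ (CStarStructure.normalizer
    (StarAlgebra.elemental ℂ (u : A)).toNonUnitalStarSubalgebra)).topologicalClosure
  exact h.mem_of_monomial (K := K.toNonUnitalSubalgebra.toSubmodule)
    (NonUnitalStarSubalgebra.isClosed_topologicalClosure _) (fun a => subset_closure
      (NonUnitalStarAlgebra.subset_adjoin ℂ _ (h.monomial_mem_normalizer a))) x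

variable (hq : ∀ n : ℤ, q ^ n = 1 → n = 0)

include hq

theorem averageLimit_mem {E : A →L[ℂ] A} (hE : IsAverageLimit u E) (a : A) :
    E a ∈ StarAlgebra.elemental ℂ (u : A) := by
  refine h.mem_of_monomial
    (K := (Subalgebra.toSubmodule (StarAlgebra.elemental ℂ (u : A)).toSubalgebra).comap
      E.toLinearMap)
    ((StarAlgebra.elemental.isClosed ℂ (u : A)).preimage E.continuous) (fun b => ?_) a
  change E (unitaryMonomial u v b) ∈ StarAlgebra.elemental ℂ (u : A)
  rw [h.averageLimit_u hq hE]
  split_ifs with hb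
  -- The unitaries lying in `C*(u)` form a group, which covers negative powers of `u`.
  · let G : Subgroup (unitary A) :=
      { carrier := {w | (w : A) ∈ StarAlgebra.elemental ℂ (u : A)}
        mul_mem' := fun {x y} hx hy =>
          mul_mem (S := StarSubalgebra ℂ A) (s := StarAlgebra.elemental ℂ (u : A))
            (a := (x : A)) (b := (y : A)) hx hy
        one_mem' := one_mem (StarAlgebra.elemental ℂ (u : A))
        inv_mem' := fun {x} hx =>
          star_mem (s := StarAlgebra.elemental ℂ (u : A)) (r := (x : A)) hx }
    have hG : u ^ b.1 ∈ G := G.zpow_mem (StarAlgebra.elemental.self_mem ℂ (u : A)) _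
    rw [unitaryMonomial, hb, zpow_zero, mul_one]
    exact hG
  · exact zero_mem _

/-- An element of a larger commutative algebra commutes with `u`, so it is fixed by `E`, whose
values lie in `C*(u)`. -/
theorem isMaximalAbelian : CStarStructure.IsMaximalAbelian
    (StarAlgebra.elemental ℂ (u : A)).toNonUnitalStarSubalgebra := by
  obtain ⟨E, hE⟩ := exists_isAverageLimit h.dense_conjEigenvectors_u
  refine ⟨StarAlgebra.elemental.isClosed ℂ (u : A), fun x hx y hy => commute_of_mem_elemental hx hy,
    fun D' _ hD' hle => le_antisymm (fun x hx => ?_) hle⟩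
  have h1 := hD' u (hle (StarAlgebra.elemental.self_mem ℂ _)) x hx
  rw [← hE.apply_of_commute h1]
  exact h.averageLimit_mem hq hE x

theorem isCartan [PartialOrder A] [StarOrderedRing A] : CStarStructure.IsCartan
    (StarAlgebra.elemental ℂ (u : A)).toNonUnitalStarSubalgebra := by
  obtain ⟨E, hE⟩ := exists_isAverageLimit h.dense_conjEigenvectors_u
  have hcomm {d : A} (hd : d ∈ StarAlgebra.elemental ℂ (u : A)) : (u : A) * d = d * u :=
    commute_of_mem_elemental (StarAlgebra.elemental.self_mem ℂ _) hd
  exact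
    { separable := h.separableSpace
      maximalAbelian := h.isMaximalAbelian hq
      approximateUnit := ⟨pure 1, .pure_one A, by
        rw [Filter.eventually_pure]; exact one_mem (StarAlgebra.elemental ℂ (u : A))⟩
      regular := h.isRegular
      expectation := ⟨hE.toCompletelyPositiveMap,
        { mem := h.averageLimit_mem hq hE
          apply_of_mem := fun d hd => hE.apply_of_commute (hcomm hd)
          norm_le := hE.norm_le
          mul_left := fun d hd a => hE.apply_mul_left (hcomm hd) a
          mul_right := fun d hd a => hE.apply_mul_right (hcomm hd) a },
        fun a ha => (CStarRing.star_mul_self_eq_zero_iff a).mp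
          (hE.eq_zero_of_nonneg h.dense_conjEigenvectors_u (star_mul_self_nonneg a) ha)⟩ }

end IsRotationPair

end Cartan

/-! ### Irrationality of `θ` and the main theorem. -/

theorem circle_exp_zpow_eq_one {θ : ℝ} (hθ : Irrational θ) (n : ℤ)
    (h : Circle.exp (2 * Real.pi * θ) ^ n = 1) : n = 0 := by
  by_contra hn
  rw [← Circle.exp_zsmul, Circle.exp_eq_one] at h
  obtain ⟨m, hm⟩ := h
  have hpi : (2 * Real.pi) ≠ 0 := by positivity
  have h1 : θ * n = m := by
    apply mul_left_cancel₀ hpi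
    rw [zsmul_eq_mul] at hm
    linarith
  exact (hθ.mul_intCast hn) ⟨m, by rw [h1]; simp⟩

theorem mainTheorem10 (θ : ℝ) (hθ : Irrational θ) :
    (CStarStructure.IsSimple (RotationAlgebra.rotationAlgebra θ) ∧
      CStarStructure.IsNuclear (RotationAlgebra.rotationAlgebra θ)) ∧
    (∃ τ : RotationAlgebra.rotationAlgebra θ →ₗ[ℂ] ℂ,
      CStarStructure.IsTracialState τ ∧ CStarStructure.IsFaithful τ ∧
      (∀ m n : ℤ, τ (RotationAlgebra.monomial θ m n) = if m = 0 ∧ n = 0 then 1 else 0) ∧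
      ∀ τ' : RotationAlgebra.rotationAlgebra θ →ₗ[ℂ] ℂ,
        CStarStructure.IsTracialState τ' → τ' = τ) ∧
    (Function.Injective (RotationAlgebra.circleHom θ) ∧
      (RotationAlgebra.circleHom θ).range =
        StarAlgebra.elemental ℂ (RotationAlgebra.U θ : RotationAlgebra.rotationAlgebra θ) ∧
      CStarStructure.IsCartan
        (StarAlgebra.elemental ℂ
          (RotationAlgebra.U θ : RotationAlgebra.rotationAlgebra θ)).toNonUnitalStarSubalgebra) ∧
    ((∃ S : StarSubalgebra ℂ (RotationAlgebra.rotationAlgebra θ),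
        (S : Set (RotationAlgebra.rotationAlgebra θ)) =
          Submodule.span ℂ {x | ∃ m n : ℤ, x = RotationAlgebra.monomial θ m n} ∧
        Dense (S : Set (RotationAlgebra.rotationAlgebra θ))) ∧
      ∀ m n p q : ℤ,
        RotationAlgebra.monomial θ m n * RotationAlgebra.monomial θ p q =
          Complex.exp (2 * Real.pi * Complex.I * θ * n * p) •
            RotationAlgebra.monomial θ (m + p) (n + q)) := by
  have h := isRotationPair θ
  have hq := circle_exp_zpow_eq_one hθ
  -- `A_θ` is nonzero because it contains a copy of `C(S¹)`.
  have : Nontrivial (RotationAlgebra.rotationAlgebra θ) := (circleHom_injective θ).nontrivial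
  obtain ⟨E, hE⟩ := exists_isAverageLimit h.dense_conjEigenvectors_u
  obtain ⟨F, hF⟩ := exists_isAverageLimit h.dense_conjEigenvectors_v
  obtain ⟨τ, hτ⟩ := h.exists_trace hq hE hF
  have hc := h.isCanonicalTrace hq hE hF hτ
  have hset : {x | ∃ m n : ℤ, x = RotationAlgebra.monomial θ m n} =
      Set.range (unitaryMonomial (RotationAlgebra.U θ) (RotationAlgebra.V θ)) := by
    ext x
    simp only [Set.mem_ofPred_eq, Set.mem_range, Prod.exists, monomial_eq, eq_comm]
  refine ⟨⟨h.isSimple hq, h.isNuclear hc⟩, ⟨τ, hc.isTracialState, hc.isFaithful, fun m n => ?_,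
    fun τ' hτ' => tracialState_unique hE hF hτ hτ'⟩, ⟨circleHom_injective θ, circleHom_range θ,
    h.isCartan hq⟩, ⟨monomialSubalgebra h.comm, ?_, h.dense⟩, fun m n p q => ?_⟩
  · refine (hc.apply_monomial (m, n)).trans (if_congr ?_ rfl rfl)
    simp
  · rw [hset]; rfl
  · rw [monomial_eq, monomial_eq, monomial_eq, h.unitaryMonomial_mul]
    congr 1
    rw [← Circle.exp_zsmul, Circle.coe_exp]
    congr 1
    simp only [zsmul_eq_mul]
    push_cast
    ring

end
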